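/- Let $\Omega\subset\mathbb R^3$ be a bounded domain with (strong) Lipschitz boundary $\Gamma=\partial\Omega$, i.e. near each boundary point, in suitable Cartesian coordinates, $\Omega$ is the part of space below the graph of a Lipschitz function. Let $\nu$ be the almost everywhere defined outer unit normal. Let $\Gamma_t\subset\Gamma$ be relatively open with $\emptyset\neq\Gamma_t\neq\Gamma$, and let $\Gamma_n:=\Gamma\setminus\overline{\Gamma_t}$. Let $H^1_{t,n}(\Omega)$ be the closure in $H^1(\Omega;\mathbb R^3)$ of the set of restrictions to $\Omega$ of fields $v\in C_c^\infty(\mathbb R^3;\mathbb R^3)$ with $v-(\nu\cdot v)\nu=0$ a.e. on $\Gamma_t$ and $\nu\cdot v=0$ a.e. on $\Gamma_n$ (with respect to surface measure). Let $\omega\in\mathbb R$ and $\sigma,b\in\mathbb R^3$ with $|\sigma|=1$, and assume that $r(x)=\omega\,\sigma\wedge x+b$ is not constant and that $r\in H^1_{t,n}(\Omega)$. Put $$g_r:=\{\lambda\sigma+\tfrac1\omega\,\sigma\wedge b:\ \lambda\in\mathbb R\}.$$ A set is called axisymmetric with respect to $g_r$ if it is invariant under all rotations about $g_r$; a surface axisymmetric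 with respect to $g_r$ means here a surface of revolution, i.e. a set swept out by rotating a locally Lipschitz curve $\gamma:\mathbb R\to\mathbb R^3$ about $g_r$ (self-intersections are allowed). Then: 1. $\langle\sigma,b\rangle=0$. 2. There is a countable family $\mathcal P$ of affine planes, each containing $g_r$, such that $\Gamma_t\subset\bigcup\mathcal P$. Moreover, every point of $\Gamma_t$ has a neighbourhood $U$ such that $\Gamma_t\cap U$ is contained in the union of at most two planes of $\mathcal P$. 3. Every connected component $C$ of $\Gamma_n$ is a subset of a surface which is axisymmetric with respect to $g_r$. Moreover, every point of $C$ has a neighbourhood $U$ such that $C\cap U=A\cap U$ for some set $A$ that is axisymmetric with respect to $g_r$. -/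

import Mathlib

open Set Filter Topology MeasureTheory
open scoped ENNReal NNReal

/-- Euclidean three-space. -/
abbrev E3 : Type := EuclideanSpace ℝ (Fin 3)

/-- The Euclidean plane, the domain of local boundary parametrizations. -/
abbrev E2 : Type := EuclideanSpace ℝ (Fin 2)

noncomputable section

/-- The vector product `u ∧ v`. -/
def wedge (u v : E3) : E3 := WithLp.toLp 2 (crossProduct u.ofLp v.ofLp)

/-- `Φ` is a Cartesian coordinate system in which, near `p`, the set `Ω` is the part of space lying
strictly below the graph of the Lipschitz function `h`. -/
structure IsLipschitzChart (Ω : Set E3) (p : E3) (Φ : E3 ≃ᵃⁱ[ℝ] E3) (h : E2 → ℝ) : Prop where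
  lipschitz : ∃ K : ℝ≥0, LipschitzWith K h
  mem_iff : ∃ δ : ℝ, 0 < δ ∧ ∀ x ∈ Metric.ball p δ, x ∈ Ω ↔ Φ x 2 < h !₂[Φ x 0, Φ x 1]

/-- A bounded (strong) Lipschitz domain in `ℝ³`. -/
structure IsBoundedLipschitzDomain (Ω : Set E3) : Prop where
  isOpen : IsOpen Ω
  isConnected : IsConnected Ω
  isBounded : Bornology.IsBounded Ω
  exists_chart : ∀ p ∈ frontier Ω, ∃ (Φ : E3 ≃ᵃⁱ[ℝ] E3) (h : E2 → ℝ), IsLipschitzChart Ω p Φ h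

/-- `ν` is the outer unit normal of `Ω` at the boundary point `p`: in a chart whose graph function
`h` is differentiable below `p`, it is `(-∇h, 1) / √(1 + |∇h|²)`. For a Lipschitz domain it
exists at almost every boundary point, and it does not depend on the chart. -/
def IsOuterUnitNormal (Ω : Set E3) (p ν : E3) : Prop :=
  p ∈ frontier Ω ∧
  ∃ (Φ : E3 ≃ᵃⁱ[ℝ] E3) (h : E2 → ℝ), IsLipschitzChart Ω p Φ h ∧
    DifferentiableAt ℝ h !₂[Φ p 0, Φ p 1] ∧
    ν = Φ.linearIsometryEquiv.symm
      ((Real.sqrt (1 + ‖gradient h !₂[Φ p 0, Φ p 1]‖ ^ 2))⁻¹ •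
        !₂[-(gradient h !₂[Φ p 0, Φ p 1] 0), -(gradient h !₂[Φ p 0, Φ p 1] 1), 1])

/-- The part `Γ_n = Γ \ closure Γ_t` of the boundary `Γ` of `Ω`. -/
def normalPart (Ω Γt : Set E3) : Set E3 := frontier Ω \ closure Γt

/-- The smooth compactly supported vector fields on `ℝ³` whose tangential component vanishes
almost everywhere on `Γ_t` and whose normal component vanishes almost everywhere on `Γ_n`,
with respect to surface measure. -/
structure IsMixedTestField (Ω Γt : Set E3) (φ : E3 → E3) : Prop where
  smooth : ContDiff ℝ (⊤ : ℕ∞) φ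
  compactSupport : HasCompactSupport φ
  tangential : ∀ᵐ x ∂(Measure.hausdorffMeasure 2 : Measure E3), x ∈ Γt →
    ∀ ν, IsOuterUnitNormal Ω x ν → φ x - (inner ℝ ν (φ x)) • ν = 0
  normal : ∀ᵐ x ∂(Measure.hausdorffMeasure 2 : Measure E3), x ∈ normalPart Ω Γt →
    ∀ ν, IsOuterUnitNormal Ω x ν → inner ℝ ν (φ x) = 0

/-- `G` is the weak derivative (weak Jacobian) of the vector field `v` in `Ω`. -/
def HasWeakDerivOn (Ω : Set E3) (v : E3 → E3) (G : E3 → E3 →L[ℝ] E3) : Prop :=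
  ∀ ψ : E3 → ℝ, ContDiff ℝ (⊤ : ℕ∞) ψ → HasCompactSupport ψ → tsupport ψ ⊆ Ω →
    ∀ e : E3, ∫ x in Ω, (fderiv ℝ ψ x e) • v x = - ∫ x in Ω, ψ x • G x e

/-- `v ∈ H¹_{t,n}(Ω)`: `v` is in `H¹(Ω)`, and it is in the closure of the mixed test fields
with respect to the norm of `H¹(Ω)`. -/
def MemH1tn (Ω Γt : Set E3) (v : E3 → E3) : Prop :=
  ∃ G : E3 → E3 →L[ℝ] E3,
    MemLp v 2 (volume.restrict Ω) ∧ MemLp G 2 (volume.restrict Ω) ∧ HasWeakDerivOn Ω v G ∧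
    ∀ ε : ℝ≥0∞, 0 < ε → ∃ φ : E3 → E3, IsMixedTestField Ω Γt φ ∧
      eLpNorm (fun x => v x - φ x) 2 (volume.restrict Ω) < ε ∧
      eLpNorm (fun x => G x - fderiv ℝ φ x) 2 (volume.restrict Ω) < ε

/-- The line `a + ℝ σ`. -/
def axisLine (a σ : E3) : Set E3 := {x | ∃ t : ℝ, x = t • σ + a}

/-- The rotation by the angle `θ` about the line `a + ℝ σ`, for a unit vector `σ`. -/
def rotAbout (a σ : E3) (θ : ℝ) (x : E3) : E3 :=
  a + Real.cos θ • (x - a) + Real.sin θ • wedge σ (x - a)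
    + ((1 - Real.cos θ) * inner ℝ σ (x - a)) • σ

/-- `S` is invariant under all rotations about the line `a + ℝ σ`. -/
def IsAxisymmetric (a σ : E3) (S : Set E3) : Prop :=
  ∀ θ : ℝ, ∀ x ∈ S, rotAbout a σ θ x ∈ S

/-- `S` is a surface of revolution about the line `a + ℝ σ`: it is swept out by a locally Lipschitz
curve rotating about that line. (Self-intersections are allowed.) -/
def IsSurfaceOfRevolution (a σ : E3) (S : Set E3) : Prop :=
  ∃ γ : ℝ → E3, LocallyLipschitz γ ∧ S = {x | ∃ s θ : ℝ, x = rotAbout a σ θ (γ s)}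

end

/-! Everything goes through a weak notion of tangency, `IsWeaklyTangent`: the divergence of every
cut-off of the field integrates to zero over the domain. A mixed test field is parallel to the
normal on Γ_t, so its vector product with any constant `e` is tangent there; on Γ_n the test field
itself is tangent. The divergence theorem below a Lipschitz graph (`IsChartOn.integral_dvg_eq_zero`)
makes these fields weakly tangent, and the property survives limits in H¹
(`MemH1tn.isWeaklyTangent`). So `e ∧ r` is weakly tangent near Γ_t for every `e`, and `r` is weakly
tangent near Γ_n.

Weak tangency yields pointwise information through flows: if a weakly tangent field has constant
divergence and a smooth flow, the flow keeps boundary points on the boundary for as long as it stays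
in the region (`IsSmoothFlow.mem_frontier`). No regularity of the boundary beyond the graph property
is needed.

Near Γ_t, Stokes' theorem gives that the axis direction σ is weakly tangent
(`isWeaklyTangent_axis`), and `σ ∧ r` is a multiple of the radial field. If ⟨σ, b⟩ were not zero,
all constant fields would be weakly tangent, among them the vertical of a chart, along which a graph
cannot be translated into itself. Invariance under translations along the axis and dilations from it
forces the boundary, off the axis, to be locally a plane through the axis. The axis cuts a chart
into at most two sides, each carrying one plane (`eventually_mem_two_planes`); Lindelöf gives
countability.

Since ⟨σ, b⟩ = 0, `r` is a rotation field, so the boundary near Γ_n is locally invariant under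
rotation. Short arcs of orbits stay in one component, which gives local axisymmetry. Orbits near a
boundary point cross a suitable vertical plane, which cuts the graph in a Lipschitz arc; countably
many such arcs are joined into one profile curve (`IsRotationTangent.exists_isSurfaceOfRevolution`).
-/

noncomputable section

/-! ### Vector algebra and the divergence. -/

/-- The vector product with a fixed left factor, as a continuous linear map. -/
def wedgeL (u : E3) : E3 →L[ℝ] E3 :=
  LinearMap.toContinuousLinearMap
    { toFun := wedge u
      map_add' := fun x y => by simp [wedge]
      map_smul' := fun c x => by simp [wedge] }

@[simp] theorem wedgeL_apply (u v : E3) : wedgeL u v = wedge u v := rfl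

theorem E3.ext {x y : E3} (h0 : x 0 = y 0) (h1 : x 1 = y 1) (h2 : x 2 = y 2) : x = y := by
  ext i; fin_cases i <;> assumption

theorem E2.ext {x y : E2} (h0 : x 0 = y 0) (h1 : x 1 = y 1) : x = y := by
  ext i; fin_cases i <;> assumption

@[simp] theorem wedge_zero_coord (u v : E3) : wedge u v 0 = u 1 * v 2 - u 2 * v 1 := by
  simp [wedge, cross_apply]
@[simp] theorem wedge_one_coord (u v : E3) : wedge u v 1 = u 2 * v 0 - u 0 * v 2 := by
  simp [wedge, cross_apply]
@[simp] theorem wedge_two_coord (u v : E3) : wedge u v 2 = u 0 * v 1 - u 1 * v 0 := by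
  simp [wedge, cross_apply]

theorem E3.inner_eq (u v : E3) : inner ℝ u v = u 0 * v 0 + u 1 * v 1 + u 2 * v 2 := by
  simp [PiLp.inner_apply, Fin.sum_univ_three, mul_comm]

theorem E2.inner_eq (u v : E2) : inner ℝ u v = u 0 * v 0 + u 1 * v 1 := by
  simp [PiLp.inner_apply, Fin.sum_univ_two, mul_comm]

theorem E3.sq_sum_eq_one {σ : E3} (hσ : ‖σ‖ = 1) : σ 0 ^ 2 + σ 1 ^ 2 + σ 2 ^ 2 = 1 := by
  have := EuclideanSpace.real_norm_sq_eq σ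
  rw [hσ, Fin.sum_univ_three] at this; linarith

theorem wedge_add (u v w : E3) : wedge u (v + w) = wedge u v + wedge u w := map_add (wedgeL u) v w
theorem wedge_sub (u v w : E3) : wedge u (v - w) = wedge u v - wedge u w := map_sub (wedgeL u) v w
theorem wedge_smul (u : E3) (c : ℝ) (v : E3) : wedge u (c • v) = c • wedge u v :=
  map_smul (wedgeL u) c v
theorem wedge_self (u : E3) : wedge u u = 0 := by simp [wedge]
theorem wedge_zero (u : E3) : wedge u 0 = 0 := map_zero (wedgeL u)

theorem inner_wedge_self_left (u v : E3) : inner ℝ u (wedge u v) = 0 := by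
  rw [E3.inner_eq]; simp; ring

theorem inner_wedge_self_right (u v : E3) : inner ℝ v (wedge u v) = 0 := by
  rw [E3.inner_eq]; simp; ring

theorem wedge_wedge {σ : E3} (hσ : ‖σ‖ = 1) (x : E3) :
    wedge σ (wedge σ x) = (inner ℝ σ x : ℝ) • σ - x := by
  have h := E3.sq_sum_eq_one hσ
  rw [E3.inner_eq]
  apply E3.ext <;> simp
  · linear_combination (-x 0) * h
  · linear_combination (-x 1) * h
  · linear_combination (-x 2) * h

/-- The trace of a continuous linear endomorphism, as a continuous linear functional. -/
def traceL : (E3 →L[ℝ] E3) →L[ℝ] ℝ :=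
  LinearMap.toContinuousLinearMap
    ((LinearMap.trace ℝ E3) ∘ₗ (ContinuousLinearMap.coeLM ℝ))

theorem traceL_apply (A : E3 →L[ℝ] E3) : traceL A = LinearMap.trace ℝ E3 (A : E3 →ₗ[ℝ] E3) := rfl

theorem traceL_eq_sum (A : E3 →L[ℝ] E3) :
    traceL A = ∑ i : Fin 3, A (EuclideanSpace.single i 1) i := by
  rw [traceL_apply, LinearMap.trace_eq_sum_inner _ (EuclideanSpace.basisFun (Fin 3) ℝ)]
  simp [EuclideanSpace.inner_single_left]

theorem traceL_smulRight (f : E3 →L[ℝ] ℝ) (x : E3) : traceL (f.smulRight x) = f x := by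
  rw [traceL_apply]
  exact LinearMap.trace_smulRight (f : E3 →ₗ[ℝ] ℝ) x

/-- The divergence of a vector field. -/
def dvg (F : E3 → E3) (x : E3) : ℝ := traceL (fderiv ℝ F x)

theorem dvg_smul {ψ : E3 → ℝ} {v : E3 → E3} {x : E3} (hψ : DifferentiableAt ℝ ψ x)
    (hv : DifferentiableAt ℝ v x) :
    dvg (fun x => ψ x • v x) x = fderiv ℝ ψ x (v x) + ψ x * dvg v x := by
  rw [dvg, fderiv_fun_smul hψ hv, map_add, map_smul, traceL_smulRight, smul_eq_mul, add_comm]; rfl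

theorem dvg_add {v w : E3 → E3} {x : E3} (hv : DifferentiableAt ℝ v x)
    (hw : DifferentiableAt ℝ w x) : dvg (fun x => v x + w x) x = dvg v x + dvg w x := by
  rw [dvg, fderiv_fun_add hv hw, map_add]; rfl

theorem continuous_dvg {F : E3 → E3} (hF : ContDiff ℝ 1 F) : Continuous (dvg F) :=
  traceL.continuous.comp (hF.continuous_fderiv one_ne_zero)

theorem HasCompactSupport.dvg {F : E3 → E3} (hF : HasCompactSupport F) :
    HasCompactSupport (dvg F) :=
  (hF.fderiv ℝ).comp_left (g := traceL) (map_zero traceL)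

/-- The divergence is invariant under Cartesian changes of coordinates. -/
theorem dvg_conj (Φ : E3 ≃ᵃⁱ[ℝ] E3) {F : E3 → E3} (hF : Differentiable ℝ F) (x : E3) :
    dvg (fun z => Φ.linearIsometryEquiv (F (Φ.symm z))) (Φ x) = dvg F x := by
  have h1 : HasFDerivAt (fun z => Φ.symm z)
      ((Φ.linearIsometryEquiv.symm : E3 ≃L[ℝ] E3) : E3 →L[ℝ] E3) (Φ x) := by
    have : (fun z => Φ.symm z) = fun z => Φ.linearIsometryEquiv.symm (z - Φ x) + x := by
      funext z
      have := Φ.symm.map_vsub z (Φ x)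
      simp only [vsub_eq_sub, AffineIsometryEquiv.symm_apply_apply] at this
      rw [← sub_eq_iff_eq_add]; exact this.symm
    rw [this]
    exact (((Φ.linearIsometryEquiv.symm : E3 ≃L[ℝ] E3).hasFDerivAt).comp (Φ x)
      ((hasFDerivAt_id (Φ x)).sub_const (Φ x))).add_const x
  have h2 : HasFDerivAt F (fderiv ℝ F x) (Φ.symm (Φ x)) := by
    rw [AffineIsometryEquiv.symm_apply_apply]; exact (hF x).hasFDerivAt
  have h3 := ((Φ.linearIsometryEquiv : E3 ≃L[ℝ] E3).hasFDerivAt).comp (Φ x) (h2.comp (Φ x) h1)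
  have h4 : fderiv ℝ (fun z => Φ.linearIsometryEquiv (F (Φ.symm z))) (Φ x) = _ := h3.fderiv
  rw [dvg, dvg, h4, traceL_apply, traceL_apply]
  exact LinearMap.trace_conj' (fderiv ℝ F x : E3 →ₗ[ℝ] E3) Φ.linearIsometryEquiv.toLinearEquiv

/-! ### The divergence theorem below a Lipschitz graph. -/

/-- The third coordinate vector. -/
def vert : E3 := EuclideanSpace.single 2 1

@[simp] theorem vert_zero : vert 0 = 0 := by simp [vert]
@[simp] theorem vert_one : vert 1 = 0 := by simp [vert]
@[simp] theorem vert_two : vert 2 = 1 := by simp [vert]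

/-- The horizontal plane as a subspace of space. -/
def planeEmb : E2 →L[ℝ] E3 :=
  LinearMap.toContinuousLinearMap
    { toFun := fun y => !₂[y 0, y 1, 0]
      map_add' := fun x y => by apply E3.ext <;> simp
      map_smul' := fun c x => by apply E3.ext <;> simp }

/-- The projection of space onto the horizontal plane. -/
def planeProj : E3 →L[ℝ] E2 :=
  LinearMap.toContinuousLinearMap
    { toFun := fun x => !₂[x 0, x 1]
      map_add' := fun x y => by apply E2.ext <;> simp
      map_smul' := fun c x => by apply E2.ext <;> simp }

theorem planeProj_apply (x : E3) : planeProj x = !₂[x 0, x 1] := rfl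
@[simp] theorem planeEmb_zero_coord (y : E2) : planeEmb y 0 = y 0 := rfl
@[simp] theorem planeEmb_one_coord (y : E2) : planeEmb y 1 = y 1 := rfl
@[simp] theorem planeEmb_two_coord (y : E2) : planeEmb y 2 = 0 := rfl
@[simp] theorem planeProj_zero_coord (x : E3) : planeProj x 0 = x 0 := rfl
@[simp] theorem planeProj_one_coord (x : E3) : planeProj x 1 = x 1 := rfl
@[simp] theorem planeProj_planeEmb (y : E2) : planeProj (planeEmb y) = y := by
  apply E2.ext <;> simp
@[simp] theorem planeProj_vert : planeProj vert = 0 := by apply E2.ext <;> simp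

theorem planeEmb_add_vert (x : E3) : planeEmb (planeProj x) + x 2 • vert = x := by
  apply E3.ext <;> simp

/-- The coordinates adapted to the graph of `h`. -/
def shear (h : E2 → ℝ) (hh : Continuous h) : E2 × ℝ ≃ₜ E3 where
  toFun p := planeEmb p.1 + (h p.1 + p.2) • vert
  invFun x := (planeProj x, x 2 - h (planeProj x))
  left_inv p := by ext <;> simp
  right_inv x := by simp [planeEmb_add_vert]
  continuous_toFun := by fun_prop
  continuous_invFun := by fun_prop

theorem shear_apply {h : E2 → ℝ} (hh : Continuous h) (y : E2) (s : ℝ) :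
    shear h hh (y, s) = planeEmb y + (h y + s) • vert := rfl

theorem measurePreserving_shear_zero :
    MeasurePreserving (fun p : E2 × ℝ => planeEmb p.1 + p.2 • vert) := by
  have h1 := (PiLp.volume_preserving_toLp (Fin 3)).comp
    (volume_preserving_piFinSuccAbove (fun _ : Fin 3 => ℝ) 2).symm
  have h2 : MeasurePreserving (fun p : E2 × ℝ => (p.2, p.1.ofLp)) :=
    ((MeasurePreserving.id volume).prod (PiLp.volume_preserving_ofLp (Fin 2))).comp
      Measure.measurePreserving_swap
  convert h1.comp h2 using 1
  funext p
  apply E3.ext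
  · simp; rfl
  · simp; rfl
  · simp

/-- Each vertical fibre is merely translated, so no derivative of `h` enters and continuity
suffices. -/
theorem measurePreserving_shear {h : E2 → ℝ} (hh : Continuous h) :
    MeasurePreserving (shear h hh) := by
  have h1 : MeasurePreserving (fun p : E2 × ℝ => (p.1, h p.1 + p.2)) :=
    (MeasurePreserving.id volume).skew_product (g := fun y s => h y + s) (by fun_prop)
      (Eventually.of_forall fun y => (measurePreserving_add_left volume (h y)).map_eq)
  exact measurePreserving_shear_zero.comp h1

/-- The integral of a directional derivative of a compactly supported Lipschitz function is `0`. -/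
theorem LipschitzWith.integral_lineDeriv_eq_zero {K : ℝ≥0} {f : E2 → ℝ} (hf : LipschitzWith K f)
    (hc : HasCompactSupport f) (v : E2) : ∫ y, lineDeriv ℝ f y v = 0 := by
  have := LipschitzWith.integral_lineDeriv_mul_eq (μ := (volume : Measure E2))
    (LipschitzWith.const (1 : ℝ)) hf hc (-v)
  simpa [lineDeriv] using this.symm

theorem LipschitzWith.integrable_lineDeriv {K : ℝ≥0} {f : E2 → ℝ} (hf : LipschitzWith K f)
    (hc : HasCompactSupport f) (v : E2) : Integrable fun y => lineDeriv ℝ f y v := by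
  rw [← integrableOn_iff_integrable_of_support_subset (s := tsupport f)]
  · exact (hf.locallyIntegrable_lineDeriv v).integrableOn_isCompact hc
  · intro x hx
    by_contra h
    rw [notMem_tsupport_iff_eventuallyEq] at h
    exact hx (h.lineDeriv_eq.trans (by simp [lineDeriv]))

section Subgraph

variable {h : E2 → ℝ} {K : ℝ≥0} {F : E3 → E3}

theorem hasDerivAt_shear (hh : Continuous h) (hF : ContDiff ℝ 1 F) (y : E2) (s : ℝ) (j : Fin 3) :
    HasDerivAt (fun s => F (shear h hh (y, s)) j) (fderiv ℝ F (shear h hh (y, s)) vert j) s := by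
  have h1 : HasDerivAt (fun s => shear h hh (y, s)) vert s := by
    simp only [shear_apply]
    simpa using (((hasDerivAt_id s).const_add (h y)).smul_const vert).const_add (planeEmb y)
  have h2 := ((hF.differentiable one_ne_zero) (shear h hh (y, s))).hasFDerivAt.comp_hasDerivAt s h1
  exact ((EuclideanSpace.proj (𝕜 := ℝ) j).hasFDerivAt.comp_hasDerivAt s h2)

theorem lineDeriv_shear (hh : Continuous h) (hF : ContDiff ℝ 1 F) {y : E2}
    (hy : DifferentiableAt ℝ h y) (s : ℝ) (j : Fin 3) (e : E2) :
    lineDeriv ℝ (fun y => F (shear h hh (y, s)) j) y e =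
      fderiv ℝ F (shear h hh (y, s)) (planeEmb e) j +
        fderiv ℝ h y e * fderiv ℝ F (shear h hh (y, s)) vert j := by
  have h1 : HasFDerivAt (fun y => shear h hh (y, s))
      (planeEmb + (fderiv ℝ h y).smulRight vert) y := by
    simp only [shear_apply]
    exact planeEmb.hasFDerivAt.add ((hy.hasFDerivAt.add_const s).smul_const vert)
  have h2 := ((hF.differentiable one_ne_zero) (shear h hh (y, s))).hasFDerivAt.comp y h1
  have h3 := (EuclideanSpace.proj (𝕜 := ℝ) j).hasFDerivAt.comp y h2
  have h4 : lineDeriv ℝ (fun y => F (shear h hh (y, s)) j) y e = _ := (h3.hasLineDerivAt e).lineDeriv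
  rw [h4]
  simp

theorem hasCompactSupport_comp_shear (hh : Continuous h) {G : E3 → ℝ} (hG : HasCompactSupport G) :
    HasCompactSupport (fun p => G (shear h hh p)) :=
  hG.comp_isClosedEmbedding (shear h hh).isClosedEmbedding

theorem hasCompactSupport_shear_left (hh : Continuous h) {G : E3 → ℝ} (hG : HasCompactSupport G)
    (s : ℝ) : HasCompactSupport (fun y => G (shear h hh (y, s))) := by
  have : IsClosedEmbedding fun y => shear h hh (y, s) :=
    Function.LeftInverse.isClosedEmbedding (f := planeProj) (fun y => by simp [shear_apply])
      planeProj.continuous (by fun_prop)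
  exact hG.comp_isClosedEmbedding this

theorem hasCompactSupport_shear_right (hh : Continuous h) {G : E3 → ℝ} (hG : HasCompactSupport G)
    (y : E2) : HasCompactSupport (fun s => G (shear h hh (y, s))) := by
  have : IsClosedEmbedding fun s => shear h hh (y, s) :=
    Function.LeftInverse.isClosedEmbedding (f := fun x : E3 => x 2 - h y)
      (fun y => by simp [shear_apply]) (by fun_prop) (by fun_prop)
  exact hG.comp_isClosedEmbedding this

theorem integral_lineDeriv_shear (hh : LipschitzWith K h) (hF : ContDiff ℝ 1 F)
    (hc : HasCompactSupport F) (s : ℝ) (j : Fin 3) (e : E2) :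
    Integrable (fun y => lineDeriv ℝ (fun y => F (shear h hh.continuous (y, s)) j) y e) ∧
      ∫ y, lineDeriv ℝ (fun y => F (shear h hh.continuous (y, s)) j) y e = 0 := by
  obtain ⟨C, hC⟩ := hF.lipschitzWith_of_hasCompactSupport hc one_ne_zero
  have h1 : LipschitzWith _ (fun y => shear h hh.continuous (y, s)) :=
    (planeEmb.lipschitz).add
      (((ContinuousLinearMap.toSpanSingleton ℝ vert).lipschitz).comp
        (hh.add (LipschitzWith.const s)))
  have h2 := (EuclideanSpace.proj (𝕜 := ℝ) j).lipschitz.comp (hC.comp h1)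
  have h3 := hasCompactSupport_shear_left hh.continuous
    (hc.comp_left (g := fun v : E3 => v j) (by simp)) s
  exact ⟨LipschitzWith.integrable_lineDeriv h2 h3 e,
    LipschitzWith.integral_lineDeriv_eq_zero h2 h3 e⟩

theorem dvg_eq_sum (F : E3 → E3) (x : E3) : dvg F x =
    fderiv ℝ F x (planeEmb (EuclideanSpace.single 0 1)) 0 +
    fderiv ℝ F x (planeEmb (EuclideanSpace.single 1 1)) 1 + fderiv ℝ F x vert 2 := by
  have h0 : planeEmb (EuclideanSpace.single 0 1) = EuclideanSpace.single 0 1 := by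
    apply E3.ext <;> simp
  have h1 : planeEmb (EuclideanSpace.single 1 1) = EuclideanSpace.single 1 1 := by
    apply E3.ext <;> simp
  rw [h0, h1, dvg, traceL_eq_sum, Fin.sum_univ_three]; rfl

/-- The divergence theorem on the subgraph of a Lipschitz function, for a vector field that is
tangent to the graph. -/
theorem integral_dvg_subgraph_eq_zero (hh : LipschitzWith K h) (hF : ContDiff ℝ 1 F)
    (hc : HasCompactSupport F)
    (hN : ∀ᵐ y : E2, DifferentiableAt ℝ h y → F (planeEmb y + h y • vert) 2 =
      fderiv ℝ h y (EuclideanSpace.single 0 1) * F (planeEmb y + h y • vert) 0 +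
      fderiv ℝ h y (EuclideanSpace.single 1 1) * F (planeEmb y + h y • vert) 1) :
    ∫ x in {x : E3 | x 2 < h !₂[x 0, x 1]}, dvg F x = 0 := by
  have hcont := hh.continuous
  have hset : {x : E3 | x 2 < h !₂[x 0, x 1]} = (shear h hcont).symm ⁻¹' (univ ×ˢ Iio 0) := by
    ext x
    have : (shear h hcont).symm x = (planeProj x, x 2 - h (planeProj x)) := rfl
    simp [this, planeProj_apply]
  have hpre : shear h hcont ⁻¹' {x : E3 | x 2 < h !₂[x 0, x 1]} = univ ×ˢ Iio 0 := by
    rw [hset, ← preimage_comp]; simp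
  rw [← (measurePreserving_shear hcont).setIntegral_preimage_emb
    (shear h hcont).measurableEmbedding, hpre]
  set S := shear h hcont with hS
  set P : Fin 3 → E2 × ℝ → ℝ := fun j p => fderiv ℝ F (S p) vert j with hP
  set d0 : E2 → ℝ := fun y => lineDeriv ℝ h y (EuclideanSpace.single 0 1)
  set d1 : E2 → ℝ := fun y => lineDeriv ℝ h y (EuclideanSpace.single 1 1)
  have hPcont : ∀ j, Continuous (P j) := fun j => by
    have := hF.continuous_fderiv one_ne_zero
    exact (EuclideanSpace.proj (𝕜 := ℝ) j).continuous.comp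
      ((this.comp S.continuous).clm_apply continuous_const)
  have hPsupp : ∀ j, HasCompactSupport (P j) := fun j =>
    hasCompactSupport_comp_shear hcont
      ((hc.fderiv ℝ).comp_left (g := fun A : E3 →L[ℝ] E3 => A vert j) (by simp))
  have hPint : ∀ j, Integrable (P j) := fun j =>
    (hPcont j).integrable_of_hasCompactSupport (hPsupp j)
  have hbd : ∀ (e : E2), ‖e‖ = 1 → ∀ j,
      Integrable (fun p : E2 × ℝ => lineDeriv ℝ h p.1 e * P j p) := by
    intro e he j
    refine Integrable.bdd_mul (c := K) (hPint j)
      (((measurable_lineDeriv hcont).comp measurable_fst).aestronglyMeasurable) ?_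
    refine Eventually.of_forall fun p => ?_
    have := norm_lineDeriv_le_of_lipschitz ℝ hh (x₀ := p.1) (v := e)
    simpa [he] using this
  have hf : Integrable (fun p => dvg F (S p)) := by
    refine ((continuous_dvg hF).comp S.continuous).integrable_of_hasCompactSupport ?_
    exact hasCompactSupport_comp_shear hcont hc.dvg
  -- `q` is the vertical derivative of the flux `F₂ - ∂₀h F₀ - ∂₁h F₁`. By the chain rule, the
  -- divergence minus `q` consists of horizontal derivatives of `F` along the graph shifted by `s`,
  -- and these integrate to zero for each `s`.
  set q : E2 × ℝ → ℝ := fun p => P 2 p - (d0 p.1 * P 0 p + d1 p.1 * P 1 p) with hq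
  have hqint : Integrable q := (hPint 2).sub ((hbd _ (by simp) 0).add (hbd _ (by simp) 1))
  have hmu : (volume : Measure (E2 × ℝ)).restrict (univ ×ˢ Iio 0) =
      (volume : Measure E2).prod (volume.restrict (Iio (0 : ℝ))) := by
    rw [Measure.volume_eq_prod, ← Measure.prod_restrict, Measure.restrict_univ]
  have hdiff : ∀ᵐ y : E2, DifferentiableAt ℝ h y := hh.ae_differentiableAt
  have hsplit : ∫ p in univ ×ˢ Iio 0, dvg F (S p) =
      (∫ p in univ ×ˢ Iio 0, (dvg F (S p) - q p)) + ∫ p in univ ×ˢ Iio 0, q p := by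
    have := integral_add ((hf.sub hqint).integrableOn (s := univ ×ˢ Iio 0)) hqint.integrableOn
    simpa using this
  rw [hsplit]
  have hA : ∫ p in univ ×ˢ Iio 0, (dvg F (S p) - q p) = 0 := by
    rw [hmu, integral_prod_symm _ (by rw [← hmu]; exact (hf.sub hqint).integrableOn)]
    refine (integral_congr_ae (Eventually.of_forall fun s => ?_)).trans (integral_zero' _ _)
    have : ∀ᵐ y : E2, dvg F (S (y, s)) - q (y, s) =
        lineDeriv ℝ (fun y => F (S (y, s)) 0) y (EuclideanSpace.single 0 1) +
        lineDeriv ℝ (fun y => F (S (y, s)) 1) y (EuclideanSpace.single 1 1) := by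
      filter_upwards [hdiff] with y hy
      rw [lineDeriv_shear hcont hF hy, lineDeriv_shear hcont hF hy, dvg_eq_sum]
      simp only [hq, hP, d0, d1, hy.lineDeriv_eq_fderiv]
      ring
    have hz := fun j e => integral_lineDeriv_shear hh hF hc s j e
    simp only [Pi.zero_apply]
    rw [integral_congr_ae this, integral_add (hz _ _).1 (hz _ _).1, (hz _ _).2, (hz _ _).2,
      add_zero]
  -- On each vertical fibre, `q` integrates to the flux at the graph, which vanishes by tangency.
  have hB : ∫ p in univ ×ˢ Iio 0, q p = 0 := by
    rw [hmu, integral_prod _ (by rw [← hmu]; exact hqint.integrableOn)]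
    refine (integral_congr_ae ?_).trans (integral_zero' _ _)
    filter_upwards [hdiff, hN] with y hy hNy
    have hPi : ∀ j, ∫ s in Iio 0, P j (y, s) = F (planeEmb y + h y • vert) j := fun j => by
      rw [← integral_Iic_eq_integral_Iio]
      have hd : (fun s => P j (y, s)) = deriv fun s => F (S (y, s)) j := by
        funext s; exact (hasDerivAt_shear hcont hF y s j).deriv.symm
      rw [hd, HasCompactSupport.integral_Iic_deriv_eq]
      · simp [hS, shear_apply]
      · have : ContDiff ℝ 1 fun s => S (y, s) := by
          simp only [hS, shear_apply]; fun_prop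
        exact (EuclideanSpace.proj (𝕜 := ℝ) j).contDiff.comp (hF.comp this)
      · exact hasCompactSupport_shear_right hcont
          (hc.comp_left (g := fun v : E3 => v j) (by simp)) y
    have hPi' : ∀ j, IntegrableOn (fun s => P j (y, s)) (Iio 0) := fun j => by
      refine Integrable.integrableOn (Continuous.integrable_of_hasCompactSupport ?_ ?_)
      · exact (hPcont j).comp (by fun_prop)
      · exact hasCompactSupport_shear_right hcont
          ((hc.fderiv ℝ).comp_left (g := fun A : E3 →L[ℝ] E3 => A vert j) (by simp)) y
    simp only [hq, Pi.zero_apply]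
    have h0 : Integrable (fun s => d0 y * P 0 (y, s)) (volume.restrict (Iio 0)) :=
      (hPi' 0).const_mul _
    have h1 : Integrable (fun s => d1 y * P 1 (y, s)) (volume.restrict (Iio 0)) :=
      (hPi' 1).const_mul _
    have h2 : Integrable (fun s => d0 y * P 0 (y, s) + d1 y * P 1 (y, s))
      (volume.restrict (Iio 0)) := h0.add h1
    rw [integral_sub (hPi' 2) h2, integral_add h0 h1, integral_const_mul,
      integral_const_mul, hPi, hPi, hPi, hNy hy]
    simp only [d0, d1, hy.lineDeriv_eq_fderiv]
    ring
  rw [hA, hB, add_zero]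

end Subgraph

/-! ### The boundary in graph charts. -/

theorem AffineIsometryEquiv.apply_eq_linear_add (Φ : E3 ≃ᵃⁱ[ℝ] E3) (x : E3) :
    Φ x = Φ.linearIsometryEquiv x + Φ 0 := by
  have := Φ.map_vsub x 0
  simp only [vsub_eq_sub, sub_zero] at this
  rw [this]; abel

theorem AffineIsometryEquiv.volume_preserving (Φ : E3 ≃ᵃⁱ[ℝ] E3) : MeasurePreserving Φ := by
  have h := (measurePreserving_add_right (volume : Measure E3) (Φ 0)).comp
    Φ.linearIsometryEquiv.measurePreserving
  have e : ⇑Φ = (fun x => x + Φ 0) ∘ ⇑Φ.linearIsometryEquiv :=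
    funext fun x => Φ.apply_eq_linear_add x
  rw [e]
  exact h

/-- The upward direction of a Cartesian coordinate system. -/
def upDir (Φ : E3 ≃ᵃⁱ[ℝ] E3) : E3 := Φ.linearIsometryEquiv.symm vert

/-- The point of the graph of `h` above `y`, in the coordinate system `Φ`. -/
def graphPt (Φ : E3 ≃ᵃⁱ[ℝ] E3) (h : E2 → ℝ) (y : E2) : E3 :=
  Φ.symm (planeEmb y + h y • vert)

/-- The horizontal coordinates of a point. -/
def chartProj (Φ : E3 ≃ᵃⁱ[ℝ] E3) (x : E3) : E2 := planeProj (Φ x)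

section Chart

variable (Φ : E3 ≃ᵃⁱ[ℝ] E3) (h : E2 → ℝ)

@[simp] theorem apply_graphPt (y : E2) : Φ (graphPt Φ h y) = planeEmb y + h y • vert := by
  simp [graphPt]

@[simp] theorem chartProj_graphPt (y : E2) : chartProj Φ (graphPt Φ h y) = y := by
  simp [chartProj]

theorem apply_add (x v : E3) : Φ (x + v) = Φ x + Φ.linearIsometryEquiv v := by
  rw [Φ.apply_eq_linear_add, Φ.apply_eq_linear_add x, map_add]; abel

@[simp] theorem linear_upDir : Φ.linearIsometryEquiv (upDir Φ) = vert := by simp [upDir]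

@[simp] theorem apply_add_upDir (x : E3) (s : ℝ) : Φ (x + s • upDir Φ) = Φ x + s • vert := by
  rw [apply_add, map_smul, linear_upDir]

@[simp] theorem chartProj_add_upDir (x : E3) (s : ℝ) :
    chartProj Φ (x + s • upDir Φ) = chartProj Φ x := by
  simp [chartProj]

theorem norm_upDir : ‖upDir Φ‖ = 1 := by simp [upDir, vert]

variable {h} in
theorem eq_graphPt {x : E3} (hx : Φ x 2 = h (chartProj Φ x)) : x = graphPt Φ h (chartProj Φ x) := by
  rw [graphPt, ← hx, chartProj, planeEmb_add_vert, AffineIsometryEquiv.symm_apply_apply]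

theorem continuous_chartProj : Continuous (chartProj Φ) :=
  planeProj.continuous.comp Φ.continuous

variable {h} in
theorem continuous_graphPt (hh : Continuous h) : Continuous (graphPt Φ h) :=
  Φ.symm.continuous.comp (by fun_prop)

variable {h} in
theorem lipschitz_graphPt {K : ℝ≥0} (hh : LipschitzWith K h) :
    ∃ C, LipschitzWith C (graphPt Φ h) :=
  ⟨_, Φ.symm.lipschitz.comp ((planeEmb.lipschitz).add
      (((ContinuousLinearMap.toSpanSingleton ℝ vert).lipschitz).comp hh))⟩

theorem norm_planeProj_le (x : E3) : ‖planeProj x‖ ≤ ‖x‖ := by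
  rw [EuclideanSpace.norm_eq, EuclideanSpace.norm_eq]
  apply Real.sqrt_le_sqrt
  simp [Fin.sum_univ_three]
  positivity

theorem lipschitz_chartProj : LipschitzWith 1 (chartProj Φ) := by
  have h1 : LipschitzWith 1 planeProj := LipschitzWith.of_dist_le_mul fun x y => by
    rw [dist_eq_norm, dist_eq_norm, ← map_sub]; simpa using norm_planeProj_le (x - y)
  have h2 := h1.comp Φ.lipschitz
  rw [one_mul] at h2
  exact h2

end Chart

/-- Within the set `V`, the set `Ω` is the part of space below the graph of the Lipschitz function
`h` in the coordinate system `Φ`. -/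
structure IsChartOn (Ω V : Set E3) (Φ : E3 ≃ᵃⁱ[ℝ] E3) (h : E2 → ℝ) : Prop where
  lipschitz : ∃ K : ℝ≥0, LipschitzWith K h
  isOpen : IsOpen V
  mem_iff : ∀ x ∈ V, x ∈ Ω ↔ Φ x 2 < h (chartProj Φ x)

namespace IsChartOn

variable {Ω V : Set E3} {Φ : E3 ≃ᵃⁱ[ℝ] E3} {h : E2 → ℝ}

theorem continuous (H : IsChartOn Ω V Φ h) : Continuous h := H.lipschitz.choose_spec.continuous

theorem mono (H : IsChartOn Ω V Φ h) {W : Set E3} (hW : IsOpen W) (hWV : W ⊆ V) :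
    IsChartOn Ω W Φ h := ⟨H.lipschitz, hW, fun x hx => H.mem_iff x (hWV hx)⟩

theorem isLipschitzChart (H : IsChartOn Ω V Φ h) {p : E3} (hp : p ∈ V) :
    IsLipschitzChart Ω p Φ h := by
  obtain ⟨δ, hδ, hb⟩ := Metric.isOpen_iff.1 H.isOpen p hp
  exact ⟨H.lipschitz, δ, hδ, fun x hx => H.mem_iff x (hb hx)⟩

theorem mem_closure_iff (H : IsChartOn Ω V Φ h) {x : E3} (hx : x ∈ V) :
    x ∈ closure Ω ↔ Φ x 2 ≤ h (chartProj Φ x) := by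
  have hc1 : Continuous fun x => Φ x 2 :=
    (EuclideanSpace.proj (𝕜 := ℝ) (2 : Fin 3)).continuous.comp Φ.continuous
  have hc2 : Continuous fun x => h (chartProj Φ x) := H.continuous.comp (continuous_chartProj Φ)
  constructor
  · intro hcl
    by_contra! hlt
    have hopen : IsOpen (V ∩ {x | h (chartProj Φ x) < Φ x 2}) :=
      H.isOpen.inter (isOpen_lt hc2 hc1)
    obtain ⟨z, ⟨hzV, hz⟩, hzΩ⟩ := _root_.mem_closure_iff.1 hcl _ hopen ⟨hx, hlt⟩
    exact lt_asymm hz ((H.mem_iff z hzV).1 hzΩ)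
  · intro hle
    have ht : Tendsto (fun s : ℝ => x + s • upDir Φ) (𝓝[<] 0) (𝓝 x) := by
      have : Continuous fun s : ℝ => x + s • upDir Φ := by fun_prop
      simpa using (this.tendsto 0).mono_left nhdsWithin_le_nhds
    refine mem_closure_of_tendsto ht ?_
    filter_upwards [ht (H.isOpen.mem_nhds hx), self_mem_nhdsWithin] with s hs hs0
    refine (H.mem_iff _ hs).2 ?_
    simp at hs0 ⊢
    linarith

theorem mem_frontier_iff (H : IsChartOn Ω V Φ h) (hΩ : IsOpen Ω) {x : E3} (hx : x ∈ V) :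
    x ∈ frontier Ω ↔ Φ x 2 = h (chartProj Φ x) := by
  rw [hΩ.frontier_eq, Set.mem_sdiff, H.mem_closure_iff hx, H.mem_iff x hx, not_lt]
  exact ⟨fun h => le_antisymm h.1 h.2, fun h => ⟨h.le, h.ge⟩⟩

theorem eq_graphPt (H : IsChartOn Ω V Φ h) (hΩ : IsOpen Ω) {x : E3} (hx : x ∈ V)
    (hf : x ∈ frontier Ω) : x = graphPt Φ h (chartProj Φ x) :=
  _root_.eq_graphPt Φ ((H.mem_frontier_iff hΩ hx).1 hf)

theorem graphPt_mem_frontier (H : IsChartOn Ω V Φ h) (hΩ : IsOpen Ω) {y : E2}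
    (hy : graphPt Φ h y ∈ V) : graphPt Φ h y ∈ frontier Ω := by
  rw [H.mem_frontier_iff hΩ hy]; simp

/-- A graph meets each vertical line once. This is the rigidity against which invariance under flows
is played. -/
theorem add_upDir_eq_zero (H : IsChartOn Ω V Φ h) (hΩ : IsOpen Ω) {x : E3} {s : ℝ} (hx : x ∈ V)
    (hxs : x + s • upDir Φ ∈ V) (hf : x ∈ frontier Ω) (hfs : x + s • upDir Φ ∈ frontier Ω) :
    s = 0 := by
  rw [H.mem_frontier_iff hΩ hx] at hf
  rw [H.mem_frontier_iff hΩ hxs] at hfs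
  simp at hfs
  linarith

/-- The divergence theorem for a vector field that is tangent to the boundary. -/
theorem integral_dvg_eq_zero (H : IsChartOn Ω V Φ h) (hΩ : IsOpen Ω) {F : E3 → E3}
    (hF : ContDiff ℝ 1 F) (hc : HasCompactSupport F) (hs : tsupport F ⊆ V)
    (hN : ∀ᵐ y : E2, DifferentiableAt ℝ h y → graphPt Φ h y ∈ V →
      inner ℝ (Φ.linearIsometryEquiv.symm !₂[-(gradient h y 0), -(gradient h y 1), 1])
        (F (graphPt Φ h y)) = 0) :
    ∫ x in Ω, dvg F x = 0 := by
  obtain ⟨K, hK⟩ := H.lipschitz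
  set B : Set E3 := {x : E3 | x 2 < h !₂[x 0, x 1]} with hB
  have hBo : IsOpen B := isOpen_lt (by fun_prop) (hK.continuous.comp planeProj.continuous)
  have h1 : ∫ x in Ω, dvg F x = ∫ x in Φ ⁻¹' B, dvg F x := by
    rw [← integral_indicator hΩ.measurableSet,
      ← integral_indicator (hBo.preimage Φ.continuous).measurableSet]
    congr 1
    funext x
    by_cases hx : x ∈ V
    · have : x ∈ Ω ↔ x ∈ Φ ⁻¹' B := H.mem_iff x hx
      by_cases hxΩ : x ∈ Ω
      · rw [indicator_of_mem hxΩ, indicator_of_mem (this.1 hxΩ)]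
      · rw [indicator_of_notMem hxΩ, indicator_of_notMem (fun h => hxΩ (this.2 h))]
    · have : dvg F x = 0 := by
        rw [dvg, fderiv_of_notMem_tsupport ℝ (fun h => hx (hs h)), map_zero]
      simp [indicator, this]
  set G : E3 → E3 := fun z => Φ.linearIsometryEquiv (F (Φ.symm z)) with hG
  have h2 : (dvg F) = fun x => dvg G (Φ x) :=
    funext fun x => (dvg_conj Φ (hF.differentiable one_ne_zero) x).symm
  rw [h1, h2, Φ.volume_preserving.setIntegral_preimage_emb
    Φ.toHomeomorph.measurableEmbedding]
  refine integral_dvg_subgraph_eq_zero hK ?_ ?_ ?_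
  · have hsymm : ContDiff ℝ 1 fun z => Φ.symm z := by
      have : (fun z => Φ.symm z) = fun z => Φ.symm.linearIsometryEquiv z + Φ.symm 0 :=
        funext fun z => Φ.symm.apply_eq_linear_add z
      rw [this]
      exact (LinearIsometryEquiv.contDiff _).add contDiff_const
    exact (LinearIsometryEquiv.contDiff _).comp (hF.comp hsymm)
  · exact (hc.comp_homeomorph Φ.symm.toHomeomorph).comp_left (map_zero _)
  · filter_upwards [hN] with y hy hd
    have hgr : ∀ v : E2, inner ℝ (gradient h y) v = fderiv ℝ h y v := fun v =>
      inner_gradient_left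
    have hg0 : gradient h y 0 = fderiv ℝ h y (EuclideanSpace.single 0 1) := by
      rw [← hgr, E2.inner_eq]; simp
    have hg1 : gradient h y 1 = fderiv ℝ h y (EuclideanSpace.single 1 1) := by
      rw [← hgr, E2.inner_eq]; simp
    have hz : Φ.symm (planeEmb y + h y • vert) = graphPt Φ h y := rfl
    rw [← hg0, ← hg1]
    by_cases hV : graphPt Φ h y ∈ V
    · have := hy hd hV
      rw [← Φ.linearIsometryEquiv.inner_map_map, LinearIsometryEquiv.apply_symm_apply,
        E3.inner_eq] at this
      simp only [hG, hz]
      simp at this ⊢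
      linarith
    · have : F (graphPt Φ h y) = 0 := image_eq_zero_of_notMem_tsupport fun h => hV (hs h)
      simp [hG, hz, this]

/-- A property that holds almost everywhere with respect to the two-dimensional Hausdorff measure
holds at the points of the graph above almost every point of the plane. -/
theorem _root_.ae_graphPt_of_ae_hausdorffMeasure {P : E3 → Prop}
    (hP : ∀ᵐ x ∂(Measure.hausdorffMeasure 2 : Measure E3), P x) :
    ∀ᵐ y : E2, P (graphPt Φ h y) := by
  have hac : (volume : Measure E2) ≪ Measure.hausdorffMeasure 2 := by
    have : (Measure.hausdorffMeasure 2 : Measure E2).IsAddHaarMeasure := by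
      simpa using MeasureTheory.isAddHaarMeasure_hausdorffMeasure (E := E2)
    exact Measure.absolutelyContinuous_isAddHaarMeasure _ _
  apply hac
  -- The projection to the base plane does not increase distances, so the shadow of the exceptional
  -- set is null for the Hausdorff measure of the plane, hence for Lebesgue measure.
  have h1 := (lipschitz_chartProj Φ).hausdorffMeasure_image_le (d := 2) (by norm_num) {x | ¬ P x}
  rw [ae_iff] at hP
  rw [hP, mul_zero] at h1
  refine measure_mono_null ?_ (le_antisymm h1 bot_le)
  intro y hy
  exact ⟨graphPt Φ h y, hy, chartProj_graphPt Φ h y⟩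

theorem isOuterUnitNormal (H : IsChartOn Ω V Φ h) (hΩ : IsOpen Ω) {y : E2}
    (hd : DifferentiableAt ℝ h y) (hV : graphPt Φ h y ∈ V) :
    IsOuterUnitNormal Ω (graphPt Φ h y)
      ((Real.sqrt (1 + ‖gradient h y‖ ^ 2))⁻¹ •
        Φ.linearIsometryEquiv.symm !₂[-(gradient h y 0), -(gradient h y 1), 1]) := by
  have hy : !₂[Φ (graphPt Φ h y) 0, Φ (graphPt Φ h y) 1] = y := chartProj_graphPt Φ h y
  refine ⟨H.graphPt_mem_frontier hΩ hV, Φ, h, H.isLipschitzChart hV, ?_, ?_⟩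
  · rwa [hy]
  · rw [hy, map_smul]

end IsChartOn

/-! ### Weak tangency and its passage to the H¹ limit. -/

/-- In the weak sense, the normal component of the vector field `v` vanishes on the part of the
boundary of `Ω` in `V`, i.e. the divergence of every cut-off of `v` in `V` has integral `0`. -/
def IsWeaklyTangent (Ω V : Set E3) (v : E3 → E3) : Prop :=
  ∀ ψ : E3 → ℝ, ContDiff ℝ (⊤ : ℕ∞) ψ → HasCompactSupport ψ → tsupport ψ ⊆ V →
    ∫ x in Ω, dvg (fun x => ψ x • v x) x = 0

/-- A smooth function has itself as its only weak derivative. -/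
theorem HasWeakDerivOn.ae_eq_fderiv {Ω : Set E3} (hΩ : IsOpen Ω) {v : E3 → E3}
    {G : E3 → E3 →L[ℝ] E3} (hv : ContDiff ℝ 1 v) (hG : IntegrableOn G Ω)
    (h : HasWeakDerivOn Ω v G) : ∀ᵐ x ∂(volume.restrict Ω), G x = fderiv ℝ v x := by
  have hcont := hv.continuous_fderiv one_ne_zero
  have key : ∀ e : E3, ∀ᵐ x ∂(volume : Measure E3), x ∈ Ω → G x e - fderiv ℝ v x e = 0 := by
    intro e
    have hcont' : Continuous fun x => fderiv ℝ v x e := hcont.clm_apply continuous_const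
    have hGe : IntegrableOn (fun x => G x e) Ω :=
      (ContinuousLinearMap.apply ℝ E3 e).integrable_comp hG
    have hloc : LocallyIntegrableOn (fun x => G x e - fderiv ℝ v x e) Ω :=
      hGe.locallyIntegrableOn.sub (hcont'.locallyIntegrable.locallyIntegrableOn Ω)
    refine hΩ.ae_eq_zero_of_integral_contDiff_smul_eq_zero hloc fun ψ hψ hψc hψs => ?_
    have hψ1 : ContDiff ℝ 1 ψ := hψ.of_le (by exact_mod_cast le_top)
    have hz : ∀ {f : E3 → E3}, ∫ x in Ω, ψ x • f x = ∫ x, ψ x • f x := fun {f} =>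
      setIntegral_eq_integral_of_forall_compl_eq_zero fun x hx => by
        rw [image_eq_zero_of_notMem_tsupport fun hh => hx (hψs hh), zero_smul]
    have hz' : ∫ x in Ω, fderiv ℝ ψ x e • v x = ∫ x, fderiv ℝ ψ x e • v x :=
      setIntegral_eq_integral_of_forall_compl_eq_zero fun x hx => by
        rw [fderiv_of_notMem_tsupport ℝ fun hh => hx (hψs hh)]; simp
    have hi1 : Integrable fun x => ψ x • fderiv ℝ v x e :=
      (hψ.continuous.smul hcont').integrable_of_hasCompactSupport hψc.smul_right
    have hi2 : Integrable fun x => fderiv ℝ ψ x e • v x :=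
      (((hψ1.continuous_fderiv one_ne_zero).clm_apply continuous_const).smul
        hv.continuous).integrable_of_hasCompactSupport (hψc.fderiv_apply ℝ e).smul_right
    have hi3 : Integrable fun x => ψ x • v x :=
      (hψ.continuous.smul hv.continuous).integrable_of_hasCompactSupport hψc.smul_right
    have hparts := integral_smul_fderiv_eq_neg_fderiv_smul_of_integrable hi2 hi1 hi3
      (fun x _ => hψ1.differentiable one_ne_zero x) (fun x _ => hv.differentiable one_ne_zero x)
    have hw := h ψ hψ hψc hψs e
    have hiG : Integrable (fun x => ψ x • G x e) (volume.restrict Ω) := by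
      obtain ⟨C, hC⟩ := hψc.exists_bound_of_continuous hψ.continuous
      exact hGe.bdd_smul C hψ.continuous.aestronglyMeasurable (Eventually.of_forall hC)
    rw [← hz (f := fun x => G x e - fderiv ℝ v x e)]
    simp only [smul_sub]
    rw [integral_sub hiG hi1.integrableOn, hz (f := fun x => fderiv ℝ v x e), hparts, ← hz', hw]
    simp
  rw [ae_restrict_iff' hΩ.measurableSet]
  have hall : ∀ᵐ x ∂(volume : Measure E3), ∀ i : Fin 3, x ∈ Ω →
      G x (EuclideanSpace.single i 1) - fderiv ℝ v x (EuclideanSpace.single i 1) = 0 :=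
    ae_all_iff.2 fun i => key _
  filter_upwards [hall] with x hx hxΩ
  apply ContinuousLinearMap.coe_injective
  refine (EuclideanSpace.basisFun (Fin 3) ℝ).toBasis.ext fun i => ?_
  simpa using sub_eq_zero.1 (hx i hxΩ)

theorem ENNReal.eq_zero_of_forall_le_mul {a c : ℝ≥0∞} (hc : c ≠ ⊤)
    (h : ∀ ε, 0 < ε → a ≤ c * ε) : a = 0 := by
  have ht : Tendsto (fun ε : ℝ≥0∞ => c * ε) (𝓝[>] 0) (𝓝 0) := by
    have := ENNReal.Tendsto.const_mul (a := c) (tendsto_id (α := ℝ≥0∞) (x := 𝓝 0)) (Or.inr hc)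
    simpa using this.mono_left (nhdsWithin_le_nhds (s := Ioi 0))
  exact le_antisymm (ge_of_tendsto ht (by filter_upwards [self_mem_nhdsWithin] with ε hε using h ε hε))
    bot_le

/-- If `T φ` is tangent to the part of the boundary in `V` for all mixed test fields `φ`, then `T v`
is weakly tangent to it for all smooth fields `v` in `H¹_{t,n}`. -/
theorem MemH1tn.isWeaklyTangent {Ω V Γt : Set E3} {Φ : E3 ≃ᵃⁱ[ℝ] E3} {h : E2 → ℝ} {v : E3 → E3}
    (hΩ : IsOpen Ω) (hb : Bornology.IsBounded Ω) (H : IsChartOn Ω V Φ h)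
    (hv : ContDiff ℝ (⊤ : ℕ∞) v) (hmem : MemH1tn Ω Γt v) (T : E3 →L[ℝ] E3)
    (hT : ∀ φ, IsMixedTestField Ω Γt φ → ∀ᵐ x ∂(Measure.hausdorffMeasure 2 : Measure E3), x ∈ V →
      ∀ ν, IsOuterUnitNormal Ω x ν → inner ℝ ν (T (φ x)) = 0) :
    IsWeaklyTangent Ω V (fun x => T (v x)) := by
  intro ψ hψ hψc hψs
  obtain ⟨G, -, hG2, hGw, happ⟩ := hmem
  have hfin : volume Ω < ⊤ := hb.measure_lt_top
  have : IsFiniteMeasure (volume.restrict Ω) := ⟨by simpa using hfin⟩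
  have hψ1 : ContDiff ℝ 1 ψ := hψ.of_le (by exact_mod_cast le_top)
  have hv1 : ContDiff ℝ 1 v := hv.of_le (by exact_mod_cast le_top)
  have hGv := hGw.ae_eq_fderiv hΩ hv1 (hG2.integrable (by norm_num))
  -- For the test fields this is the divergence theorem; the rest of the proof is the limit.
  have htest : ∀ φ, IsMixedTestField Ω Γt φ →
      ∫ x in Ω, dvg (fun x => ψ x • T (φ x)) x = 0 := by
    intro φ hφ
    have hφ1 : ContDiff ℝ 1 φ := hφ.smooth.of_le (by exact_mod_cast le_top)
    refine H.integral_dvg_eq_zero hΩ (hψ1.smul (T.contDiff.comp hφ1)) hψc.smul_right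
      ((tsupport_smul_subset_left ψ _).trans hψs) ?_
    filter_upwards [ae_graphPt_of_ae_hausdorffMeasure (Φ := Φ) (h := h) (hT φ hφ)] with y hy hd hV
    have := hy hV _ (H.isOuterUnitNormal hΩ hd hV)
    rw [real_inner_smul_left] at this
    have hne : (Real.sqrt (1 + ‖gradient h y‖ ^ 2))⁻¹ ≠ 0 := by positivity
    rw [real_inner_smul_right, (mul_eq_zero.1 this).resolve_left hne, mul_zero]
  obtain ⟨C1, hC1⟩ := (hψc.fderiv ℝ).exists_bound_of_continuous (hψ1.continuous_fderiv one_ne_zero)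
  obtain ⟨C2, hC2⟩ := hψc.exists_bound_of_continuous hψ1.continuous
  have hC1' : 0 ≤ C1 := (norm_nonneg _).trans (hC1 0)
  have hC2' : 0 ≤ C2 := (norm_nonneg _).trans (hC2 0)
  have hcont : ∀ u : E3 → E3, ContDiff ℝ 1 u →
      Integrable (fun x => dvg (fun x => ψ x • T (u x)) x) (volume.restrict Ω) := fun u hu => by
    have h1 : ContDiff ℝ 1 fun x => ψ x • T (u x) := hψ1.smul (T.contDiff.comp hu)
    have h2 : HasCompactSupport fun x => ψ x • T (u x) := hψc.smul_right
    exact ((continuous_dvg h1).integrable_of_hasCompactSupport h2.dvg).integrableOn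
  have hbound : ∀ u : E3 → E3, ContDiff ℝ 1 u → ∀ x, ‖dvg (fun x => ψ x • T (u x)) x‖ ≤
      C1 * ‖T‖ * ‖u x‖ + C2 * (‖traceL‖ * ‖T‖) * ‖fderiv ℝ u x‖ := by
    intro u hu x
    have hud := hu.differentiable one_ne_zero x
    rw [dvg_smul (v := fun x => T (u x)) (hψ1.differentiable one_ne_zero x)
      (T.differentiableAt.comp x hud)]
    have hTu : dvg (fun x => T (u x)) x = traceL (T ∘L fderiv ℝ u x) := by
      rw [dvg]
      congr 1
      exact (T.hasFDerivAt.comp x hud.hasFDerivAt).fderiv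
    refine (norm_add_le _ _).trans (add_le_add ?_ ?_)
    · calc ‖fderiv ℝ ψ x (T (u x))‖ ≤ ‖fderiv ℝ ψ x‖ * (‖T‖ * ‖u x‖) :=
            (ContinuousLinearMap.le_opNorm _ _).trans (by gcongr; exact T.le_opNorm _)
        _ ≤ C1 * (‖T‖ * ‖u x‖) := by gcongr; exact hC1 x
        _ = _ := by ring
    · rw [norm_mul, hTu]
      calc ‖ψ x‖ * ‖traceL (T ∘L fderiv ℝ u x)‖
          ≤ C2 * (‖traceL‖ * (‖T‖ * ‖fderiv ℝ u x‖)) := by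
            gcongr
            · exact hC2 x
            · exact (ContinuousLinearMap.le_opNorm _ _).trans
                (by gcongr; exact ContinuousLinearMap.opNorm_comp_le _ _)
        _ = _ := by ring
  -- Hölder constant for passing from L² to L¹ on the bounded set Ω.
  set M : ℝ≥0∞ := (volume.restrict Ω) univ ^ (1 / (1 : ℝ≥0∞).toReal - 1 / (2 : ℝ≥0∞).toReal) with hM
  have hMtop : M ≠ ⊤ := ENNReal.rpow_ne_top_of_nonneg (by norm_num) (measure_ne_top _ _)
  set D1 : ℝ≥0∞ := ENNReal.ofReal (C1 * ‖T‖)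
  set D2 : ℝ≥0∞ := ENNReal.ofReal (C2 * (‖traceL‖ * ‖T‖))
  suffices hs : ‖∫ x in Ω, dvg (fun x => ψ x • T (v x)) x‖ₑ = 0 by simpa using hs
  refine ENNReal.eq_zero_of_forall_le_mul (c := D1 * M + D2 * M)
    (by simp [ENNReal.mul_eq_top, hMtop, D1, D2]) fun ε hε => ?_
  obtain ⟨φ, hφ, h1, h2⟩ := happ ε hε
  have hφ1 : ContDiff ℝ 1 φ := hφ.smooth.of_le (by exact_mod_cast le_top)
  set u : E3 → E3 := fun x => v x - φ x with hu
  have hu1 : ContDiff ℝ 1 u := hv1.sub hφ1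
  have hdu : ∀ x, fderiv ℝ u x = fderiv ℝ v x - fderiv ℝ φ x := fun x =>
    fderiv_sub (hv1.differentiable one_ne_zero x) (hφ1.differentiable one_ne_zero x)
  -- The approximation is stated for the weak derivative `G`, which for smooth `v` is the classical
  -- one.
  have h2' : eLpNorm (fun x => fderiv ℝ u x) 2 (volume.restrict Ω) < ε := by
    refine lt_of_eq_of_lt (eLpNorm_congr_ae ?_) h2
    filter_upwards [hGv] with x hx
    rw [hdu, hx]
  -- The test field contributes nothing, so only the small difference `u` has to be estimated.
  have hsub : ∫ x in Ω, dvg (fun x => ψ x • T (v x)) x =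
      ∫ x in Ω, dvg (fun x => ψ x • T (u x)) x := by
    have : ∀ x, dvg (fun x => ψ x • T (v x)) x =
        dvg (fun x => ψ x • T (u x)) x + dvg (fun x => ψ x • T (φ x)) x := by
      intro x
      have e1 : DifferentiableAt ℝ (fun x => ψ x • T (u x)) x :=
        (hψ1.smul (T.contDiff.comp hu1)).differentiable one_ne_zero x
      have e2 : DifferentiableAt ℝ (fun x => ψ x • T (φ x)) x :=
        (hψ1.smul (T.contDiff.comp hφ1)).differentiable one_ne_zero x
      rw [← dvg_add e1 e2]
      congr 1
      funext z
      rw [← smul_add, ← map_add, hu]; simp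
    simp_rw [this]
    rw [integral_add (hcont u hu1) (hcont φ hφ1), htest φ hφ, add_zero]
  rw [hsub]
  have hcu : Continuous u := hu1.continuous
  have hcdu : Continuous fun x => fderiv ℝ u x := hu1.continuous_fderiv one_ne_zero
  calc ‖∫ x in Ω, dvg (fun x => ψ x • T (u x)) x‖ₑ
      ≤ ∫⁻ x in Ω, ‖dvg (fun x => ψ x • T (u x)) x‖ₑ := enorm_integral_le_lintegral_enorm _
    _ ≤ ∫⁻ x in Ω, (D1 * ‖u x‖ₑ + D2 * ‖fderiv ℝ u x‖ₑ) := by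
        refine lintegral_mono fun x => ?_
        rw [← ofReal_norm, ← ofReal_norm, ← ofReal_norm, ← ENNReal.ofReal_mul (by positivity),
          ← ENNReal.ofReal_mul (by positivity), ← ENNReal.ofReal_add (by positivity) (by positivity)]
        exact ENNReal.ofReal_le_ofReal (hbound u hu1 x)
    _ = D1 * eLpNorm u 1 (volume.restrict Ω) +
        D2 * eLpNorm (fun x => fderiv ℝ u x) 1 (volume.restrict Ω) := by
        rw [lintegral_add_left (by fun_prop), lintegral_const_mul _ (by fun_prop),
          lintegral_const_mul _ (by fun_prop), eLpNorm_one_eq_lintegral_enorm,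
          eLpNorm_one_eq_lintegral_enorm]
    _ ≤ D1 * (ε * M) + D2 * (ε * M) := by
        gcongr
        · exact (eLpNorm_le_eLpNorm_mul_rpow_measure_univ (one_le_two (α := ℝ≥0∞))
            hcu.aestronglyMeasurable).trans (by gcongr)
        · exact (eLpNorm_le_eLpNorm_mul_rpow_measure_univ (one_le_two (α := ℝ≥0∞))
            hcdu.aestronglyMeasurable).trans (by gcongr)
    _ = (D1 * M + D2 * M) * ε := by ring

theorem IsWeaklyTangent.mono {Ω V W : Set E3} {v : E3 → E3} (h : IsWeaklyTangent Ω V v)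
    (hWV : W ⊆ V) : IsWeaklyTangent Ω W v :=
  fun ψ hψ hψc hψs => h ψ hψ hψc (hψs.trans hWV)

/-- The factor is absorbed into the cut-off. Together with `IsWeaklyTangent.add`, this allows smooth
coefficients when combining tangent fields. -/
theorem IsWeaklyTangent.smul {Ω V : Set E3} {v : E3 → E3} (h : IsWeaklyTangent Ω V v) {f : E3 → ℝ}
    (hf : ContDiff ℝ (⊤ : ℕ∞) f) : IsWeaklyTangent Ω V (fun x => f x • v x) := by
  intro ψ hψ hψc hψs
  simp only [smul_smul]
  exact h (fun x => ψ x * f x) (hψ.mul hf) hψc.mul_right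
    ((tsupport_mul_subset_left).trans hψs)

theorem integrable_dvg_smul {ψ : E3 → ℝ} {v : E3 → E3} (hψ : ContDiff ℝ (⊤ : ℕ∞) ψ)
    (hψc : HasCompactSupport ψ) (hv : ContDiff ℝ (⊤ : ℕ∞) v) :
    Integrable (fun x => dvg (fun x => ψ x • v x) x) := by
  have h1 : ContDiff ℝ 1 (fun x => ψ x • v x) := (hψ.smul hv).of_le (by exact_mod_cast le_top)
  have h2 : HasCompactSupport (fun x => ψ x • v x) := hψc.smul_right
  exact (continuous_dvg h1).integrable_of_hasCompactSupport h2.dvg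

theorem IsWeaklyTangent.add {Ω V : Set E3} {v w : E3 → E3} (h : IsWeaklyTangent Ω V v)
    (h' : IsWeaklyTangent Ω V w) (hv : ContDiff ℝ (⊤ : ℕ∞) v) (hw : ContDiff ℝ (⊤ : ℕ∞) w) :
    IsWeaklyTangent Ω V (fun x => v x + w x) := by
  intro ψ hψ hψc hψs
  have : ∀ x, dvg (fun x => ψ x • (v x + w x)) x =
      dvg (fun x => ψ x • v x) x + dvg (fun x => ψ x • w x) x := fun x => by
    simp only [smul_add]
    exact dvg_add ((hψ.smul hv).differentiable (by simp) x)
      ((hψ.smul hw).differentiable (by simp) x)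
  simp_rw [this]
  rw [integral_add (integrable_dvg_smul hψ hψc hv).integrableOn
    (integrable_dvg_smul hψ hψc hw).integrableOn, h ψ hψ hψc hψs, h' ψ hψ hψc hψs, add_zero]

/-! ### Flows of weakly tangent fields preserve the boundary. -/

/-- `Θ` is the flow of the vector field `v`, and it is smooth. -/
structure IsSmoothFlow (Θ : ℝ → E3 → E3) (v : E3 → E3) : Prop where
  smooth : ContDiff ℝ (⊤ : ℕ∞) (fun p : ℝ × E3 => Θ p.1 p.2)
  zero : ∀ x, Θ 0 x = x
  add : ∀ s t x, Θ (s + t) x = Θ s (Θ t x)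
  hasDerivAt : ∀ x, HasDerivAt (fun t => Θ t x) (v x) 0

namespace IsSmoothFlow

variable {Θ : ℝ → E3 → E3} {v : E3 → E3}

theorem neg_apply (h : IsSmoothFlow Θ v) (t : ℝ) (x : E3) : Θ (-t) (Θ t x) = x := by
  rw [← h.add, neg_add_cancel, h.zero]

theorem apply_neg (h : IsSmoothFlow Θ v) (t : ℝ) (x : E3) : Θ t (Θ (-t) x) = x := by
  rw [← h.add, add_neg_cancel, h.zero]

theorem continuous (h : IsSmoothFlow Θ v) : Continuous (fun p : ℝ × E3 => Θ p.1 p.2) :=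
  h.smooth.continuous

theorem continuous_right (h : IsSmoothFlow Θ v) (t : ℝ) : Continuous (Θ t) :=
  h.continuous.comp (by fun_prop : Continuous fun x : E3 => (t, x))

theorem contDiff_right (h : IsSmoothFlow Θ v) (t : ℝ) : ContDiff ℝ (⊤ : ℕ∞) (Θ t) :=
  h.smooth.comp (by fun_prop : ContDiff ℝ (⊤ : ℕ∞) fun x : E3 => (t, x))

/-- Splitting off the increment first, `Θ t' = Θ t ∘ Θ (t' - t)`, puts the derivative in the form of
a transport equation with velocity `v x` at the starting point. -/
theorem hasDerivAt_comp (h : IsSmoothFlow Θ v) {ψ : E3 → ℝ} (hψ : ContDiff ℝ (⊤ : ℕ∞) ψ) (t : ℝ)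
    (x : E3) : HasDerivAt (fun t => ψ (Θ t x)) (fderiv ℝ (fun z => ψ (Θ t z)) x (v x)) t := by
  have h1 : DifferentiableAt ℝ (fun z => ψ (Θ t z)) (Θ 0 x) :=
    (hψ.comp (h.contDiff_right t)).differentiable (by simp) _
  have h2 := h1.hasFDerivAt.comp_hasDerivAt 0 (h.hasDerivAt x)
  rw [h.zero] at h2
  have h3 : HasDerivAt (fun t' : ℝ => t' - t) 1 t := (hasDerivAt_id t).sub_const t
  have h4 := HasDerivAt.scomp_of_eq t h2 h3 (sub_self t).symm
  rw [one_smul] at h4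
  refine h4.congr_of_eventuallyEq (Eventually.of_forall fun t' => ?_)
  simp only [Function.comp]
  rw [← h.add, add_sub_cancel]

theorem eventually_forall_mem (h : IsSmoothFlow Θ v) {V I : Set _} (hV : IsOpen V)
    (hI : IsCompact I) {x : E3} (hx : ∀ s ∈ I, Θ s x ∈ V) : ∀ᶠ y in 𝓝 x, ∀ s ∈ I, Θ s y ∈ V := by
  refine hI.eventually_forall_of_forall_eventually fun s hs => ?_
  have hc : Continuous fun z : E3 × ℝ => Θ z.2 z.1 := h.continuous.comp continuous_swap
  exact hc.continuousAt.eventually_mem (hV.mem_nhds (hx s hs))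

variable {Ω V : Set E3} {d : ℝ}

/-- The function `K t x = exp (t d) ψ (Θ t x)` satisfies `∂ₜK = d K + v · ∇K = div (K v)`. Its
integral over Ω is therefore constant in time, provided that the support of `K t` stays in the
region of weak tangency, which is what `hψs` ensures. -/
theorem integral_comp_eq (h : IsSmoothFlow Θ v) (hb : Bornology.IsBounded Ω)
    (hv : Differentiable ℝ v) (hd : ∀ x, dvg v x = d) (hw : IsWeaklyTangent Ω V v) {T : ℝ}
    {ψ : E3 → ℝ} (hψ : ContDiff ℝ (⊤ : ℕ∞) ψ) (hψc : HasCompactSupport ψ)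
    (hψs : ∀ t ∈ uIcc 0 T, ∀ y ∈ tsupport ψ, Θ (-t) y ∈ V) :
    ∫ x in Ω, Real.exp (T * d) * ψ (Θ T x) = ∫ x in Ω, ψ x := by
  set K : ℝ → E3 → ℝ := fun t x => Real.exp (t * d) * ψ (Θ t x) with hK
  have hKs : ContDiff ℝ (⊤ : ℕ∞) (fun p : ℝ × E3 => K p.1 p.2) :=
    (Real.contDiff_exp.comp (contDiff_fst.mul contDiff_const)).mul (hψ.comp h.smooth)
  have hKt : ∀ t, ContDiff ℝ (⊤ : ℕ∞) (K t) := fun t =>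
    hKs.comp (by fun_prop : ContDiff ℝ (⊤ : ℕ∞) fun x : E3 => (t, x))
  set D : ℝ → E3 → ℝ := fun t x => fderiv ℝ (fun p : ℝ × E3 => K p.1 p.2) (t, x) (1, 0) with hD
  have hDc : Continuous (fun p : ℝ × E3 => D p.1 p.2) :=
    (hKs.continuous_fderiv (by simp)).clm_apply continuous_const
  have hKD : ∀ t x, HasDerivAt (fun t => K t x) (D t x) t := fun t x => by
    have h1 : HasDerivAt (fun t : ℝ => (t, x)) (1, 0) t :=
      (hasDerivAt_id t).prodMk (hasDerivAt_const t x)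
    exact ((hKs.differentiable (by simp)) (t, x)).hasFDerivAt.comp_hasDerivAt t h1
  have hDd : ∀ t x, D t x = dvg (fun x => K t x • v x) x := fun t x => by
    rw [dvg_smul ((hKt t).differentiable (by simp) x) (hv x), hd]
    have h1 : HasDerivAt (fun t => Real.exp (t * d)) (Real.exp (t * d) * d) t := by
      simpa using ((hasDerivAt_id t).mul_const d).exp
    have h2 := (hKD t x).unique (h1.mul (h.hasDerivAt_comp hψ t x))
    have h3 : fderiv ℝ (K t) x = Real.exp (t * d) • fderiv ℝ (fun z => ψ (Θ t z)) x :=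
      fderiv_const_mul ((hψ.comp (h.contDiff_right t)).differentiable (by simp) x) _
    rw [h2, h3]
    simp only [hK, _root_.smul_apply, smul_eq_mul]
    ring
  have hzero : ∀ t ∈ uIcc 0 T, ∫ x in Ω, D t x = 0 := by
    intro t ht
    simp_rw [hDd]
    have hsub : tsupport (K t) ⊆ Θ (-t) '' tsupport ψ := by
      refine closure_minimal ?_ (hψc.isCompact.image (h.continuous_right _)).isClosed
      intro x hx
      refine ⟨Θ t x, subset_tsupport _ ?_, h.neg_apply t x⟩
      simp only [hK, Function.mem_support, ne_eq, mul_eq_zero, not_or] at hx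
      exact hx.2
    refine hw (K t) (hKt t) ?_ ?_
    · exact (hψc.isCompact.image (h.continuous_right _)).of_isClosed_subset
        (isClosed_tsupport _) hsub
    · rintro x hx
      obtain ⟨y, hy, rfl⟩ := hsub hx
      exact hψs t ht y hy
  have hint : IntegrableOn (fun p : ℝ × E3 => D p.1 p.2) (uIoc 0 T ×ˢ Ω) := by
    refine (hDc.continuousOn.integrableOn_compact
      (isCompact_uIcc.prod hb.isCompact_closure)).mono_set (prod_mono uIoc_subset_uIcc subset_closure)
  have hKint : ∀ t, IntegrableOn (K t) Ω := fun t =>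
    ((hKt t).continuous.continuousOn.integrableOn_compact hb.isCompact_closure).mono_set
      subset_closure
  have hdiff : ∫ x in Ω, (K T x - K 0 x) = 0 := by
    calc ∫ x in Ω, (K T x - K 0 x) = ∫ x in Ω, ∫ t in (0 : ℝ)..T, D t x := by
          congr 1
          funext x
          rw [intervalIntegral.integral_eq_sub_of_hasDerivAt fun t _ => hKD t x]
          exact Continuous.intervalIntegrable
            (hDc.comp (by fun_prop : Continuous fun t : ℝ => (t, x))) _ _
      _ = ∫ t in (0 : ℝ)..T, ∫ x in Ω, D t x := by
          rw [intervalIntegral_integral_swap]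
          rw [Measure.prod_restrict]
          exact hint
      _ = ∫ t in (0 : ℝ)..T, (0 : ℝ) := intervalIntegral.integral_congr fun t ht => hzero t ht
      _ = 0 := by simp
  rw [integral_sub (hKint T) (hKint 0), sub_eq_zero] at hdiff
  rw [hdiff]
  simp [hK, h.zero]

/-- Otherwise a bump at `Θ T x`, supported off Ω, would have integral zero over Ω, whereas its
pull-back by the flow is positive near `x ∈ Ω`. -/
theorem mem_closure_of_mem (h : IsSmoothFlow Θ v) (hΩ : IsOpen Ω) (hb : Bornology.IsBounded Ω)
    (hv : Differentiable ℝ v) (hd : ∀ x, dvg v x = d) (hV : IsOpen V)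
    (hw : IsWeaklyTangent Ω V v) {T : ℝ} {x : E3} (hx : x ∈ Ω)
    (hxV : ∀ s ∈ uIcc 0 T, Θ s x ∈ V) : Θ T x ∈ closure Ω := by
  by_contra hT
  have h1 : ∀ s ∈ (fun s => -s) '' uIcc 0 T, Θ s (Θ T x) ∈ V := by
    rintro _ ⟨s, hs, rfl⟩
    rw [← h.add]
    refine hxV _ ?_
    rw [mem_uIcc] at hs ⊢
    rcases hs with hs | hs
    · left; constructor <;> linarith [hs.1, hs.2]
    · right; constructor <;> linarith [hs.1, hs.2]
  have h2 := h.eventually_forall_mem hV (isCompact_uIcc.image continuous_neg) h1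
  obtain ⟨δ, hδ, hball⟩ := Metric.mem_nhds_iff.1
    (h2.and (isClosed_closure.isOpen_compl.mem_nhds hT))
  let ψ : ContDiffBump (Θ T x) := ⟨δ / 4, δ / 2, by positivity, by linarith⟩
  have hts : tsupport ψ ⊆ Metric.ball (Θ T x) δ := by
    rw [ψ.tsupport_eq]
    exact Metric.closedBall_subset_ball (by change δ / 2 < δ; linarith)
  have hI := h.integral_comp_eq hb hv hd hw (T := T) ψ.contDiff ψ.hasCompactSupport
    (fun t ht y hy => (hball (hts hy)).1 _ ⟨t, ht, rfl⟩)
  have hz : ∫ z in Ω, ψ z = 0 := by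
    refine setIntegral_eq_zero_of_forall_eq_zero fun z hz => ?_
    exact image_eq_zero_of_notMem_tsupport fun hz' => (hball (hts hz')).2 (subset_closure hz)
  have hcont : Continuous fun z => Real.exp (T * d) * ψ (Θ T z) :=
    continuous_const.mul (ψ.continuous.comp (h.continuous_right T))
  rw [hz] at hI
  have hpos : 0 < ∫ z in Ω, Real.exp (T * d) * ψ (Θ T z) := by
    rw [setIntegral_pos_iff_support_of_nonneg_ae]
    · refine (hcont.isOpen_support.inter hΩ).measure_pos _ ⟨x, ?_, hx⟩
      have : ψ (Θ T x) = 1 := ψ.one_of_mem_closedBall (Metric.mem_closedBall_self (by simp [ψ]; positivity))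
      simp [this]
    · exact Eventually.of_forall fun z => mul_nonneg (Real.exp_pos _).le ψ.nonneg
    · exact (hcont.continuousOn.integrableOn_compact hb.isCompact_closure).mono_set subset_closure
  exact hpos.ne' hI

/-- The flow of a vector field that is weakly tangent to the boundary preserves the boundary. -/
theorem mem_frontier (h : IsSmoothFlow Θ v) (hΩ : IsOpen Ω) (hb : Bornology.IsBounded Ω)
    (hreg : interior (closure Ω) = Ω)
    (hv : Differentiable ℝ v) (hd : ∀ x, dvg v x = d) (hV : IsOpen V)
    (hw : IsWeaklyTangent Ω V v) {T : ℝ} {x : E3} (hx : x ∈ frontier Ω)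
    (hxV : ∀ s ∈ uIcc 0 T, Θ s x ∈ V) : Θ T x ∈ frontier Ω := by
  have hcl : ∀ {T : ℝ} {x : E3}, x ∈ closure Ω → (∀ s ∈ uIcc 0 T, Θ s x ∈ V) →
      Θ T x ∈ closure Ω := by
    intro T x hx hxV
    have h1 := h.eventually_forall_mem hV isCompact_uIcc hxV
    have h2 : ∃ᶠ y in 𝓝 x, y ∈ Ω := mem_closure_iff_frequently.1 hx
    have h3 : ∃ᶠ y in 𝓝 x, Θ T y ∈ closure Ω := (h2.and_eventually h1).mono fun y hy =>
      h.mem_closure_of_mem hΩ hb hv hd hV hw hy.1 hy.2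
    have h4 := (h.continuous_right T).continuousAt.tendsto.frequently h3
    rw [← closure_closure]
    exact mem_closure_iff_frequently.2 h4
  have hop : ∀ {T : ℝ} {x : E3}, x ∈ Ω → (∀ s ∈ uIcc 0 T, Θ s x ∈ V) → Θ T x ∈ Ω := by
    intro T x hx hxV
    -- The previous lemma only reaches the closure. Applied to all points near `x`, it gives a whole
    -- neighbourhood of `Θ T x` in the closure, and regularity of Ω brings this back into Ω.
    rw [← hreg, mem_interior_iff_mem_nhds]
    have h1 := (h.eventually_forall_mem hV isCompact_uIcc hxV).and (hΩ.mem_nhds hx)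
    have h2 : Tendsto (Θ (-T)) (𝓝 (Θ T x)) (𝓝 x) := by
      have := (h.continuous_right (-T)).tendsto (Θ T x)
      rwa [h.neg_apply] at this
    filter_upwards [h2 h1] with y hy
    have := h.mem_closure_of_mem hΩ hb hv hd hV hw hy.2 hy.1
    rwa [h.apply_neg] at this
  rw [hΩ.frontier_eq] at hx ⊢
  refine ⟨hcl hx.1 hxV, fun hT => hx.2 ?_⟩
  -- Run backwards, the flow would carry a point that had entered Ω to the starting point, which is
  -- not in Ω.
  have := hop (T := -T) hT fun s hs => by
    rw [← h.add]
    refine hxV _ ?_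
    rw [mem_uIcc] at hs ⊢
    rcases hs with hs | hs
    · right; constructor <;> linarith [hs.1, hs.2]
    · left; constructor <;> linarith [hs.1, hs.2]
  rwa [h.neg_apply] at this

end IsSmoothFlow

theorem IsBoundedLipschitzDomain.exists_isChartOn {Ω : Set E3} (hΩ : IsBoundedLipschitzDomain Ω)
    {p : E3} (hp : p ∈ frontier Ω) :
    ∃ (Φ : E3 ≃ᵃⁱ[ℝ] E3) (h : E2 → ℝ) (δ : ℝ), 0 < δ ∧ IsChartOn Ω (Metric.ball p δ) Φ h := by
  obtain ⟨Φ, h, hK, δ, hδ, hm⟩ := hΩ.exists_chart p hp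
  exact ⟨Φ, h, δ, hδ, hK, Metric.isOpen_ball, hm⟩

/-- Just above a boundary point, the chart leaves the closure, so the boundary contains no slits. -/
theorem IsBoundedLipschitzDomain.interior_closure {Ω : Set E3} (hΩ : IsBoundedLipschitzDomain Ω) :
    interior (closure Ω) = Ω := by
  refine Subset.antisymm (fun p hp => ?_) (hΩ.isOpen.subset_interior_closure)
  by_contra hpΩ
  have hf : p ∈ frontier Ω := by
    rw [hΩ.isOpen.frontier_eq]; exact ⟨interior_subset hp, hpΩ⟩
  obtain ⟨Φ, h, δ, hδ, H⟩ := hΩ.exists_isChartOn hf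
  have ht : Tendsto (fun s : ℝ => p + s • upDir Φ) (𝓝[>] 0) (𝓝 p) := by
    have : Continuous fun s : ℝ => p + s • upDir Φ := by fun_prop
    simpa using (this.tendsto 0).mono_left nhdsWithin_le_nhds
  have h1 := ht.eventually_mem (isOpen_interior.mem_nhds hp)
  have h2 := ht.eventually_mem (Metric.ball_mem_nhds p hδ)
  obtain ⟨s, ⟨hs1, hs2⟩, hs0⟩ := ((h1.and h2).and self_mem_nhdsWithin).exists
  have h3 := (H.mem_closure_iff hs2).1 (interior_subset hs1)
  have h4 := (H.mem_frontier_iff hΩ.isOpen (Metric.mem_ball_self hδ)).1 hf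
  simp at h3 hs0
  linarith

/-! ### The radial field of an axis. -/

/-- The vector from the closest point of the line `a + ℝ σ` to `x`. -/
def radial (a σ x : E3) : E3 := x - a - (inner ℝ σ (x - a) : ℝ) • σ

theorem inner_self_one {σ : E3} (hσ : ‖σ‖ = 1) : inner ℝ σ σ = 1 := by
  rw [real_inner_self_eq_norm_sq, hσ, one_pow]

theorem inner_radial {a σ : E3} (hσ : ‖σ‖ = 1) (x : E3) : inner ℝ σ (radial a σ x) = 0 := by
  rw [radial, inner_sub_right, real_inner_smul_right, inner_self_one hσ]; ring

theorem radial_add_smul_radial {a σ : E3} (hσ : ‖σ‖ = 1) (x : E3) (c : ℝ) :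
    radial a σ (x + c • radial a σ x) = (1 + c) • radial a σ x := by
  have : inner ℝ σ (x + c • radial a σ x - a) = inner ℝ σ (x - a) := by
    rw [add_sub_right_comm, inner_add_right, real_inner_smul_right, inner_radial hσ]; ring
  conv_lhs => rw [radial, this]
  rw [add_smul, one_smul]
  nth_rewrite 2 [radial]
  abel

theorem contDiff_inner_sub (σ a : E3) :
    ContDiff ℝ (⊤ : ℕ∞) (fun x : E3 => (inner ℝ σ (x - a) : ℝ)) :=
  contDiff_const.inner ℝ (contDiff_id.sub contDiff_const)

theorem contDiff_radial (a σ : E3) : ContDiff ℝ (⊤ : ℕ∞) (radial a σ) := by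
  have := contDiff_inner_sub σ a
  unfold radial; fun_prop

theorem contDiff_wedge (u : E3) : ContDiff ℝ (⊤ : ℕ∞) (wedge u) := (wedgeL u).contDiff

theorem wedge_wedge_left {σ : E3} (hσ : ‖σ‖ = 1) (a x : E3) :
    wedge σ (wedge σ (x - a)) = -radial a σ x := by
  rw [wedge_wedge hσ, radial]; abel

/-! ### Flows -/

theorem isSmoothFlow_translation (u : E3) : IsSmoothFlow (fun t x => x + t • u) (fun _ => u) where
  smooth := by fun_prop
  zero x := by simp
  add s t x := by rw [add_smul]; abel
  hasDerivAt x := by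
    simpa using ((hasDerivAt_id (0 : ℝ)).smul_const u).const_add x

/-- Dilation from the axis by the factor `exp t`, the axial coordinate being kept. It is the one
flow used here whose field has non-zero divergence, namely 2. -/
theorem isSmoothFlow_scaling {a σ : E3} (hσ : ‖σ‖ = 1) :
    IsSmoothFlow (fun t x => x + (Real.exp t - 1) • radial a σ x) (radial a σ) where
  smooth := by
    have := contDiff_radial a σ
    fun_prop
  zero x := by simp
  add s t x := by
    rw [radial_add_smul_radial hσ, Real.exp_add]
    module
  hasDerivAt x := by
    have h1 : HasDerivAt (fun t => Real.exp t - 1) 1 0 := by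
      simpa using (Real.hasDerivAt_exp 0).sub_const 1
    simpa using (h1.smul_const (radial a σ x)).const_add x

theorem rotAbout_eq {a σ : E3} (x : E3) (θ : ℝ) :
    rotAbout a σ θ x = x + (Real.cos θ - 1) • radial a σ x + Real.sin θ • wedge σ (x - a) := by
  rw [rotAbout, radial]; module

theorem radial_rotAbout {a σ : E3} (hσ : ‖σ‖ = 1) (x : E3) (θ : ℝ) :
    radial a σ (rotAbout a σ θ x) =
      Real.cos θ • radial a σ x + Real.sin θ • wedge σ (x - a) := by
  have h1 : rotAbout a σ θ x - a = (x - a) + (Real.cos θ - 1) • radial a σ x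
      + Real.sin θ • wedge σ (x - a) := by
    rw [rotAbout_eq]; abel
  have h2 : inner ℝ σ (rotAbout a σ θ x - a) = inner ℝ σ (x - a) := by
    rw [h1, inner_add_right, inner_add_right, real_inner_smul_right, real_inner_smul_right,
      inner_radial hσ, inner_wedge_self_left]; ring
  conv_lhs => rw [radial, h2, h1]
  simp only [radial]; module

theorem wedge_radial (a σ x : E3) : wedge σ (radial a σ x) = wedge σ (x - a) := by
  rw [radial, wedge_sub, wedge_smul, wedge_self, smul_zero, sub_zero]

theorem wedge_rotAbout {a σ : E3} (hσ : ‖σ‖ = 1) (x : E3) (θ : ℝ) :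
    wedge σ (rotAbout a σ θ x - a) =
      Real.cos θ • wedge σ (x - a) - Real.sin θ • radial a σ x := by
  rw [← wedge_radial, radial_rotAbout hσ, wedge_add, wedge_smul, wedge_smul, wedge_radial,
    wedge_wedge_left hσ, smul_neg, ← sub_eq_add_neg]

theorem isSmoothFlow_rotation {a σ : E3} (hσ : ‖σ‖ = 1) :
    IsSmoothFlow (rotAbout a σ) (fun x => wedge σ (x - a)) where
  smooth := by
    have h := contDiff_radial a σ
    have h' : ContDiff ℝ (⊤ : ℕ∞) fun p : ℝ × E3 => wedge σ (p.2 - a) :=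
      (contDiff_wedge σ).comp (by fun_prop)
    simp only [rotAbout_eq]
    fun_prop
  zero x := by simp [rotAbout_eq]
  add s t x := by
    rw [rotAbout_eq _ s, radial_rotAbout hσ, wedge_rotAbout hσ, rotAbout_eq, rotAbout_eq,
      Real.cos_add, Real.sin_add]
    module
  hasDerivAt x := by
    simp only [rotAbout_eq]
    have h1 : HasDerivAt (fun t => Real.cos t - 1) 0 0 := by
      simpa using (Real.hasDerivAt_cos 0).sub_const 1
    have h2 : HasDerivAt Real.sin 1 0 := by simpa using Real.hasDerivAt_sin 0
    have h3 := ((h1.smul_const (radial a σ x)).const_add x).add (h2.smul_const (wedge σ (x - a)))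
    rw [zero_smul, one_smul, zero_add] at h3
    exact h3

theorem dvg_const (u x : E3) : dvg (fun _ => u) x = 0 := by simp [dvg]

theorem fderiv_radial (a σ x u : E3) :
    fderiv ℝ (radial a σ) x u = u - (inner ℝ σ u : ℝ) • σ := by
  have h : HasFDerivAt (radial a σ)
      (ContinuousLinearMap.id ℝ E3 - (innerSL ℝ σ).smulRight σ) x := by
    have h1 : HasFDerivAt (fun x : E3 => x - a) (ContinuousLinearMap.id ℝ E3) x :=
      (hasFDerivAt_id x).sub_const a
    exact h1.sub (((innerSL ℝ σ).hasFDerivAt.comp x h1).smul_const σ)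
  rw [h.fderiv]; simp

theorem dvg_radial {a σ : E3} (hσ : ‖σ‖ = 1) (x : E3) : dvg (radial a σ) x = 2 := by
  rw [dvg, traceL_eq_sum, Fin.sum_univ_three]
  have := E3.sq_sum_eq_one hσ
  simp only [fderiv_radial]
  simp [EuclideanSpace.inner_single_right]
  linarith

theorem fderiv_wedge_sub (a σ x : E3) : fderiv ℝ (fun x => wedge σ (x - a)) x = wedgeL σ :=
  ((wedgeL σ).hasFDerivAt.comp x ((hasFDerivAt_id x).sub_const a)).fderiv

theorem dvg_wedge_sub (a σ x : E3) : dvg (fun x => wedge σ (x - a)) x = 0 := by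
  rw [dvg, fderiv_wedge_sub, traceL_eq_sum, Fin.sum_univ_three]
  simp

/-! ### Rigid motions -/

/-- Screw decomposition: a rotation field about the axis plus a translation along it, whose speed
⟨σ, b⟩ is the obstruction to a pure rotation. -/
theorem rigid_eq {ω : ℝ} (hω : ω ≠ 0) {σ : E3} (hσ : ‖σ‖ = 1) (b x : E3) :
    ω • wedge σ x + b =
      ω • wedge σ (x - (1 / ω) • wedge σ b) + (inner ℝ σ b : ℝ) • σ := by
  rw [wedge_sub, wedge_smul, wedge_wedge hσ, smul_sub, smul_smul, mul_one_div_cancel hω, one_smul]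
  abel

theorem contDiff_rigid (ω : ℝ) (σ b : E3) :
    ContDiff ℝ (⊤ : ℕ∞) (fun x => ω • wedge σ x + b) :=
  ((contDiff_wedge σ).const_smul ω).add contDiff_const

/-- If the rigid motion `r` is weakly normal to the boundary, then its axis is weakly tangent. -/
theorem isWeaklyTangent_axis {Ω V : Set E3} {ω : ℝ} (hω : ω ≠ 0) {σ b : E3}
    (h : ∀ e, IsWeaklyTangent Ω V (fun x => wedge e (ω • wedge σ x + b))) :
    IsWeaklyTangent Ω V (fun _ => σ) := by
  intro η hη hηc hηs
  set r : E3 → E3 := fun x => ω • wedge σ x + b with hr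
  have hrs : ContDiff ℝ (⊤ : ℕ∞) r := contDiff_rigid ω σ b
  let E : Fin 3 → E3 := fun i => EuclideanSpace.single i 1
  -- Summing `∂ᵢη (eᵢ ∧ r)` over `i` gives `∇η ∧ r`. Its divergence is `-∇η · curl r = -2ω ∇η · σ`,
  -- the second derivatives of `η` cancelling by symmetry, and this is `-2ω div (η σ)`.
  let ψ : Fin 3 → E3 → ℝ := fun i x => fderiv ℝ η x (E i)
  have hηd : ContDiff ℝ (⊤ : ℕ∞) (fderiv ℝ η) := hη.fderiv_right (by simp)
  have hψ : ∀ i, ContDiff ℝ (⊤ : ℕ∞) (ψ i) := fun i => hηd.clm_apply contDiff_const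
  have hψc : ∀ i, HasCompactSupport (ψ i) := fun i => hηc.fderiv_apply ℝ (E i)
  have hψs : ∀ i, tsupport (ψ i) ⊆ V := fun i => (tsupport_fderiv_apply_subset ℝ (E i)).trans hηs
  have hwr : ∀ i, ContDiff ℝ (⊤ : ℕ∞) (fun x => wedge (E i) (r x)) := fun i =>
    (contDiff_wedge _).comp hrs
  have hdr : ∀ i x, dvg (fun x => wedge (E i) (r x)) x = -2 * ω * σ i := by
    intro i x
    have h1 : HasFDerivAt (fun x => wedge (E i) (r x)) (wedgeL (E i) ∘L (ω • wedgeL σ)) x :=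
      (wedgeL (E i)).hasFDerivAt.comp x (((wedgeL σ).hasFDerivAt.const_smul ω).add_const b)
    rw [dvg, h1.fderiv, traceL_eq_sum, Fin.sum_univ_three]
    fin_cases i <;> simp [E] <;> ring
  have hsymm : ∀ x u w, fderiv ℝ (fderiv ℝ η) x u w = fderiv ℝ (fderiv ℝ η) x w u := fun x u w =>
    second_derivative_symmetric (fun y => (hη.differentiable (by simp) y).hasFDerivAt)
      (hηd.differentiable (by simp) x).hasFDerivAt u w
  have hψd : ∀ i x u, fderiv ℝ (ψ i) x u = fderiv ℝ (fderiv ℝ η) x u (E i) := fun i x u => by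
    have := ((hηd.differentiable (by simp) x).hasFDerivAt.clm_apply
      (hasFDerivAt_const (E i) x)).fderiv
    change fderiv ℝ (fun y => (fderiv ℝ η y) (E i)) x u = _
    rw [this]; simp
  have hexp : ∀ u : E3, u = u 0 • E 0 + u 1 • E 1 + u 2 • E 2 := fun u => by
    apply E3.ext <;> simp [E]
  have hsum : ∀ x, ∑ i, dvg (fun x => ψ i x • wedge (E i) (r x)) x =
      (-2 * ω) * dvg (fun x => η x • σ) x := by
    intro x
    have h1 : ∀ i, dvg (fun x => ψ i x • wedge (E i) (r x)) x =
        fderiv ℝ (fderiv ℝ η) x (wedge (E i) (r x)) (E i) + fderiv ℝ η x (E i) * (-2 * ω * σ i) :=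
      fun i => by
        rw [dvg_smul ((hψ i).differentiable (by simp) x) ((hwr i).differentiable (by simp) x),
          hψd, hdr]
    rw [dvg_smul (hη.differentiable (by simp) x) (differentiableAt_const σ), dvg_const]
    simp only [h1, Fin.sum_univ_three]
    have e0 : wedge (E 0) (r x) = -(r x 2) • E 1 + r x 1 • E 2 := by
      apply E3.ext <;> simp [E]
    have e1 : wedge (E 1) (r x) = r x 2 • E 0 - r x 0 • E 2 := by
      apply E3.ext <;> simp [E]
    have e2 : wedge (E 2) (r x) = -(r x 1) • E 0 + r x 0 • E 1 := by
      apply E3.ext <;> simp [E]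
    have e3 : fderiv ℝ η x σ = σ 0 * fderiv ℝ η x (E 0) + σ 1 * fderiv ℝ η x (E 1)
        + σ 2 * fderiv ℝ η x (E 2) := by
      conv_lhs => rw [hexp σ]
      simp
    rw [e0, e1, e2, e3]
    simp only [map_add, map_sub, map_smul, _root_.add_apply, _root_.sub_apply, _root_.smul_apply,
      smul_eq_mul, hsymm x (E 1) (E 0), hsymm x (E 2) (E 0), hsymm x (E 2) (E 1)]
    ring
  have h0 : ∫ x in Ω, ∑ i, dvg (fun x => ψ i x • wedge (E i) (r x)) x = 0 := by
    rw [integral_finsetSum _ fun i _ => (integrable_dvg_smul (hψ i) (hψc i) (hwr i)).integrableOn]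
    exact Finset.sum_eq_zero fun i _ => h (E i) (ψ i) (hψ i) (hψc i) (hψs i)
  simp_rw [hsum] at h0
  rw [integral_const_mul] at h0
  exact (mul_eq_zero.1 h0).resolve_left (by simpa using hω)

/-- The product with σ kills the axial part of `r` and turns the rotation field into `-ω` times the
radial field. -/
theorem isWeaklyTangent_radial {Ω V : Set E3} {ω : ℝ} (hω : ω ≠ 0) {σ b : E3} (hσ : ‖σ‖ = 1)
    (h : ∀ e, IsWeaklyTangent Ω V (fun x => wedge e (ω • wedge σ x + b))) :
    IsWeaklyTangent Ω V (radial ((1 / ω) • wedge σ b) σ) := by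
  have := (h σ).smul (contDiff_const (c := -ω⁻¹))
  convert this using 2 with x
  rw [rigid_eq hω hσ, wedge_add, wedge_smul, wedge_smul, wedge_self, wedge_wedge_left hσ, smul_zero,
    add_zero, smul_smul, neg_mul, inv_mul_cancel₀ hω]
  simp

/-- If a rigid motion is weakly normal to the boundary and its pitch does not vanish, then all
constant fields are weakly tangent. -/
theorem isWeaklyTangent_const {Ω V : Set E3} {ω : ℝ} (hω : ω ≠ 0) {σ b : E3} (hσ : ‖σ‖ = 1)
    (hc : inner ℝ σ b ≠ (0 : ℝ))
    (h : ∀ e, IsWeaklyTangent Ω V (fun x => wedge e (ω • wedge σ x + b))) (k : E3) :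
    IsWeaklyTangent Ω V (fun _ => k) := by
  set a : E3 := (1 / ω) • wedge σ b with ha
  set c : ℝ := inner ℝ σ b with hcdef
  -- For this `e`, `e ∧ r = ω ⟨e, x - a⟩ σ + c (k - ⟨σ, k⟩ σ)`. Solving for `k` expresses it through
  -- `e ∧ r` and a smooth multiple of σ, both weakly tangent.
  set e : E3 := wedge σ k with he
  have hax := isWeaklyTangent_axis hω h
  have hbx := (h e).smul (contDiff_const (c := c⁻¹))
  have hf : ContDiff ℝ (⊤ : ℕ∞) fun x : E3 => inner ℝ σ k - c⁻¹ * ω * inner ℝ e (x - a) :=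
    contDiff_const.sub (contDiff_const.mul (contDiff_inner_sub e a))
  have hsum := hbx.add (hax.smul hf)
    (((contDiff_wedge e).comp (contDiff_rigid ω σ b)).const_smul c⁻¹)
    (hf.smul contDiff_const)
  convert hsum using 2 with x
  rw [rigid_eq hω hσ, ← ha, ← hcdef]
  have h1 : wedge e (wedge σ (x - a)) = (inner ℝ e (x - a) : ℝ) • σ := by
    have h2 : inner ℝ e σ = (0 : ℝ) := by rw [real_inner_comm, he, inner_wedge_self_left]
    rw [E3.inner_eq] at h2 ⊢
    set u := x - a
    apply E3.ext <;> simp only [wedge_zero_coord, wedge_one_coord, wedge_two_coord,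
      PiLp.smul_apply, smul_eq_mul]
    · linear_combination (-u 0) * h2
    · linear_combination (-u 1) * h2
    · linear_combination (-u 2) * h2
  have h3 : wedge e σ = k - (inner ℝ σ k : ℝ) • σ := by
    have h4 : wedge e σ = - wedge σ e := by apply E3.ext <;> simp <;> ring
    rw [h4, he, wedge_wedge hσ]; abel
  rw [wedge_add, wedge_smul, wedge_smul, h1, h3]
  match_scalars
  · field_simp
  · field_simp
    ring

theorem IsBoundedLipschitzDomain.exists_isChartOn_of_mem_inter {Ω : Set E3}
    (hΩ : IsBoundedLipschitzDomain Ω) {U : Set E3} (hU : IsOpen U) {p : E3} (hpU : p ∈ U)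
    (hp : p ∈ frontier Ω) :
    ∃ (Φ : E3 ≃ᵃⁱ[ℝ] E3) (h : E2 → ℝ) (δ : ℝ), 0 < δ ∧ Metric.ball p δ ⊆ U ∧
      IsChartOn Ω (Metric.ball p δ) Φ h := by
  obtain ⟨Φ, h, δ, hδ, H⟩ := hΩ.exists_isChartOn hp
  obtain ⟨ε, hε, hb⟩ := Metric.isOpen_iff.1 hU p hpU
  exact ⟨Φ, h, min δ ε, lt_min hδ hε,
    (Metric.ball_subset_ball (min_le_right _ _)).trans hb,
    H.mono Metric.isOpen_ball (Metric.ball_subset_ball (min_le_left _ _))⟩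

/-- Near `Γ_t`, the vector products of a smooth field in `H¹_{t,n}` with constant vectors are weakly
tangent. -/
theorem MemH1tn.isWeaklyTangent_wedge {Ω Γt V : Set E3} {Φ : E3 ≃ᵃⁱ[ℝ] E3} {h : E2 → ℝ}
    {v : E3 → E3} (hΩ : IsBoundedLipschitzDomain Ω) (hmem : MemH1tn Ω Γt v)
    (hv : ContDiff ℝ (⊤ : ℕ∞) v) (H : IsChartOn Ω V Φ h) (hV : V ∩ frontier Ω ⊆ Γt) (e : E3) :
    IsWeaklyTangent Ω V (fun x => wedge e (v x)) := by
  refine hmem.isWeaklyTangent hΩ.isOpen hΩ.isBounded H hv (wedgeL e) fun φ hφ => ?_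
  filter_upwards [hφ.tangential] with x hx hxV ν hν
  have := sub_eq_zero.1 (hx (hV ⟨hxV, hν.1⟩) ν hν)
  rw [this, wedgeL_apply, wedge_smul, real_inner_smul_right, inner_wedge_self_right, mul_zero]

/-- Near `Γ_n`, a smooth field in `H¹_{t,n}` is weakly tangent. -/
theorem MemH1tn.isWeaklyTangent_self {Ω Γt V : Set E3} {Φ : E3 ≃ᵃⁱ[ℝ] E3} {h : E2 → ℝ}
    {v : E3 → E3} (hΩ : IsBoundedLipschitzDomain Ω) (hmem : MemH1tn Ω Γt v)
    (hv : ContDiff ℝ (⊤ : ℕ∞) v) (H : IsChartOn Ω V Φ h)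
    (hV : V ∩ frontier Ω ⊆ normalPart Ω Γt) : IsWeaklyTangent Ω V v := by
  refine hmem.isWeaklyTangent hΩ.isOpen hΩ.isBounded H hv (ContinuousLinearMap.id ℝ E3)
    fun φ hφ => ?_
  filter_upwards [hφ.normal] with x hx hxV ν hν
  exact hx (hV ⟨hxV, hν.1⟩) ν hν

theorem Convex.add_smul_mem_of_uIcc {V : Set E3} (hV : Convex ℝ V) {x u : E3} {c s : ℝ} (hx : x ∈ V)
    (hxc : x + c • u ∈ V) (hs : s ∈ uIcc 0 c) : x + s • u ∈ V := by
  rcases eq_or_ne c 0 with rfl | hc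
  · rw [uIcc_self, mem_singleton_iff] at hs
    simpa [hs] using hx
  have h1 : s / c ∈ Icc (0 : ℝ) 1 := by
    rw [mem_uIcc] at hs
    rcases hs with hs | hs
    · have : 0 < c := lt_of_le_of_ne (hs.1.trans hs.2) hc.symm
      exact ⟨div_nonneg hs.1 this.le, (div_le_one this).2 hs.2⟩
    · have : c < 0 := lt_of_le_of_ne (hs.1.trans hs.2) hc
      exact ⟨div_nonneg_of_nonpos hs.2 this.le, (div_le_one_of_neg this).2 hs.1⟩
  have h2 := hV.add_smul_mem hx hxc h1
  rwa [smul_smul, div_mul_cancel₀ _ hc] at h2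

/-- If all constant fields were weakly tangent, then there would be no boundary. -/
theorem IsChartOn.not_forall_isWeaklyTangent_const {Ω : Set E3} {p : E3} {δ : ℝ}
    {Φ : E3 ≃ᵃⁱ[ℝ] E3} {h : E2 → ℝ} (hΩ : IsBoundedLipschitzDomain Ω) (hp : p ∈ frontier Ω)
    (hδ : 0 < δ) (H : IsChartOn Ω (Metric.ball p δ) Φ h)
    (hk : IsWeaklyTangent Ω (Metric.ball p δ) (fun _ => upDir Φ)) : False := by
  have hs : p + (δ / 2) • upDir Φ ∈ Metric.ball p δ := by
    rw [mem_ball_iff_norm]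
    rw [add_sub_cancel_left, norm_smul, norm_upDir, mul_one, Real.norm_of_nonneg (by positivity)]
    linarith
  have h1 := (isSmoothFlow_translation (upDir Φ)).mem_frontier hΩ.isOpen hΩ.isBounded
    hΩ.interior_closure (differentiable_const _) (dvg_const _) Metric.isOpen_ball hk hp
    (T := δ / 2) fun s hs' => (convex_ball p δ).add_smul_mem_of_uIcc (Metric.mem_ball_self hδ) hs hs'
  have := H.add_upDir_eq_zero hΩ.isOpen (Metric.mem_ball_self hδ) hs hp h1
  linarith

theorem eq_inner_smul_of_inner_eq_zero {σ u : E3} (hσ : ‖σ‖ = 1) (hu : wedge σ u = 0) :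
    u = (inner ℝ σ u : ℝ) • σ := by
  have := wedge_wedge hσ u
  rw [hu, wedge_zero] at this
  exact (sub_eq_zero.1 this.symm).symm

/-- Vectors orthogonal to `σ ∧ m` are in the span of `σ` and `m`. -/
theorem norm_sq_smul_eq {σ m v : E3} (hσ : ‖σ‖ = 1) (hm : inner ℝ σ m = (0 : ℝ))
    (hv : inner ℝ (wedge σ m) v = (0 : ℝ)) :
    (‖m‖ ^ 2) • v = (inner ℝ m v : ℝ) • m + (‖m‖ ^ 2 * inner ℝ σ v) • σ := by
  set w := v - (inner ℝ σ v : ℝ) • σ with hw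
  have hmw : inner ℝ m w = (inner ℝ m v : ℝ) := by
    rw [hw, inner_sub_right, real_inner_smul_right, real_inner_comm σ m, hm]; ring
  have hσw : inner ℝ σ w = (0 : ℝ) := by
    rw [hw, inner_sub_right, real_inner_smul_right, inner_self_one hσ]; ring
  -- `m ∧ w` is both parallel and orthogonal to σ, hence zero, so `w` has only a component along
  -- `m`.
  have h1 : wedge σ (wedge m w) = 0 := by
    have : wedge σ (wedge m w) = (inner ℝ σ w : ℝ) • m - (inner ℝ σ m : ℝ) • w := by
      rw [E3.inner_eq, E3.inner_eq]
      apply E3.ext <;> simp <;> ring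
    rw [this, hm, hσw]; simp
  have h2 : inner ℝ σ (wedge m w) = (0 : ℝ) := by
    have : inner ℝ σ (wedge m w) = (inner ℝ (wedge σ m) v : ℝ) := by
      rw [E3.inner_eq, E3.inner_eq, hw]; simp; ring
    rw [this, hv]
  have h3 : wedge m w = 0 := by
    rw [eq_inner_smul_of_inner_eq_zero hσ h1, h2, zero_smul]
  have h4 : wedge m (wedge m w) = (inner ℝ m w : ℝ) • m - (‖m‖ ^ 2) • w := by
    rw [← real_inner_self_eq_norm_sq, E3.inner_eq, E3.inner_eq]
    apply E3.ext <;> simp <;> ring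
  rw [h3, wedge_zero, hmw, hw] at h4
  have h5 := sub_eq_zero.1 h4.symm
  rw [h5]; module

/-! ### The boundary near Γ_t lies in planes through the axis. -/

section Planes

variable {Ω V : Set E3} {Φ : E3 ≃ᵃⁱ[ℝ] E3} {h : E2 → ℝ} {a σ : E3}

/-- The boundary contains the plane through the axis and the point `p`, near `p`. -/
theorem mem_frontier_of_mem_plane (hΩ : IsBoundedLipschitzDomain Ω) (hσ : ‖σ‖ = 1)
    {p : E3} {δ : ℝ} (hp : p ∈ frontier Ω) (hpa : radial a σ p ≠ 0) (hδ : 0 < δ)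
    (hax : IsWeaklyTangent Ω (Metric.ball p δ) (fun _ => σ))
    (hrad : IsWeaklyTangent Ω (Metric.ball p δ) (radial a σ)) :
    ∀ᶠ x in 𝓝 p, inner ℝ (wedge σ (p - a)) (x - p) = (0 : ℝ) → x ∈ frontier Ω := by
  set m := radial a σ p with hm
  have hm0 : 0 < ‖m‖ := norm_pos_iff.2 hpa
  have hc : Continuous fun x : E3 => 1 + (inner ℝ m (x - p) : ℝ) / ‖m‖ ^ 2 := by fun_prop
  -- This is the dilation factor taking `p` to the radial coordinate of `x`; it must be positive to
  -- be reached by the flow at time `Real.log (1 + l)`.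
  have hpos : ∀ᶠ x in 𝓝 p, 0 < 1 + (inner ℝ m (x - p) : ℝ) / ‖m‖ ^ 2 := by
    refine hc.continuousAt.eventually_const_lt ?_
    simp
  filter_upwards [hpos, Metric.ball_mem_nhds p hδ] with x hlam hxV hx
  set l : ℝ := (inner ℝ m (x - p) : ℝ) / ‖m‖ ^ 2 with hl
  set τ : ℝ := inner ℝ σ (x - p) with hτ
  have hdec : x = p + l • m + τ • σ := by
    rw [← wedge_radial, ← hm] at hx
    have h1 := norm_sq_smul_eq hσ (inner_radial hσ p) hx
    have h2 : x - p = l • m + τ • σ := by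
      apply smul_right_injective E3 (pow_ne_zero 2 hm0.ne')
      simp only
      rw [h1, hl, hτ, smul_add, smul_smul, smul_smul, mul_div_cancel₀ _ (pow_ne_zero 2 hm0.ne')]
    rw [add_assoc, ← h2]; abel
  -- The corner of the path from `p` to `x`, first radial and then axial. It is no farther from `p`
  -- than `x` is, so by convexity both legs stay in the ball.
  have h1V : p + l • m ∈ Metric.ball p δ := by
    rw [mem_ball_iff_norm] at hxV ⊢
    refine lt_of_le_of_lt ?_ hxV
    rw [add_sub_cancel_left, norm_smul, hl, norm_div, norm_pow, norm_norm, div_mul_eq_mul_div,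
      div_le_iff₀ (by positivity)]
    have := norm_inner_le_norm (𝕜 := ℝ) m (x - p)
    nlinarith
  have h1 : p + l • m ∈ frontier Ω := by
    have h2 := (isSmoothFlow_scaling (a := a) hσ).mem_frontier hΩ.isOpen hΩ.isBounded
      hΩ.interior_closure ((contDiff_radial a σ).differentiable (by simp)) (dvg_radial hσ)
      Metric.isOpen_ball hrad hp (T := Real.log (1 + l)) fun s hs => by
        refine (convex_ball p δ).add_smul_mem_of_uIcc (Metric.mem_ball_self hδ) h1V ?_
        rw [mem_uIcc] at hs ⊢
        rcases hs with hs | hs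
        · left
          have e1 := Real.exp_le_exp.2 hs.1
          have e2 := Real.exp_le_exp.2 hs.2
          rw [Real.exp_log hlam] at e2
          rw [Real.exp_zero] at e1
          constructor <;> linarith
        · right
          have e1 := Real.exp_le_exp.2 hs.1
          have e2 := Real.exp_le_exp.2 hs.2
          rw [Real.exp_log hlam] at e1
          rw [Real.exp_zero] at e2
          constructor <;> linarith
    rwa [Real.exp_log hlam, add_sub_cancel_left] at h2
  rw [hdec]
  exact (isSmoothFlow_translation σ).mem_frontier hΩ.isOpen hΩ.isBounded
    hΩ.interior_closure (differentiable_const _) (dvg_const _) Metric.isOpen_ball hax h1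
    (T := τ) fun s hs => (convex_ball p δ).add_smul_mem_of_uIcc h1V (by rwa [← hdec]) hs

/-- Off the axis, the boundary is locally contained in a plane through the axis. -/
theorem eventually_mem_plane (hΩ : IsBoundedLipschitzDomain Ω) (hσ : ‖σ‖ = 1)
    (H : IsChartOn Ω V Φ h) {p : E3} (hpV : p ∈ V) (hp : p ∈ frontier Ω) (hpa : radial a σ p ≠ 0)
    (hax : IsWeaklyTangent Ω V (fun _ => σ)) (hrad : IsWeaklyTangent Ω V (radial a σ)) :
    ∀ᶠ x in 𝓝 p, x ∈ frontier Ω → inner ℝ (wedge σ (p - a)) (x - p) = (0 : ℝ) := by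
  obtain ⟨δ, hδ, hball⟩ := Metric.isOpen_iff.1 H.isOpen p hpV
  have hev := (mem_frontier_of_mem_plane hΩ hσ hp hpa hδ (hax.mono hball) (hrad.mono hball)).and
    (H.isOpen.mem_nhds hpV)
  set n := wedge σ (p - a) with hn
  set e := upDir Φ with he
  -- A plane containing the chart's vertical would put a vertical segment into the boundary.
  have hne : inner ℝ n e ≠ (0 : ℝ) := by
    intro hne
    have ht : Tendsto (fun s : ℝ => p + s • e) (𝓝[≠] 0) (𝓝 p) := by
      have : Continuous fun s : ℝ => p + s • e := by fun_prop
      simpa using (this.tendsto 0).mono_left nhdsWithin_le_nhds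
    obtain ⟨s, ⟨hs1, hs2⟩, hs0⟩ := ((ht.eventually hev).and self_mem_nhdsWithin).exists
    refine hs0 (H.add_upDir_eq_zero hΩ.isOpen hpV hs2 hp (hs1 ?_))
    rw [add_sub_cancel_left, real_inner_smul_right, hne, mul_zero]
  -- Slide `x` vertically into the plane. The landing point is on the boundary too, so the slide has
  -- length zero and `x` was in the plane already.
  have hc : Continuous fun x : E3 => x + (-(inner ℝ n (x - p) : ℝ) / inner ℝ n e) • e := by
    fun_prop
  have ht : Tendsto (fun x : E3 => x + (-(inner ℝ n (x - p) : ℝ) / inner ℝ n e) • e) (𝓝 p)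
      (𝓝 p) := by
    simpa using hc.tendsto p
  filter_upwards [ht.eventually hev, H.isOpen.mem_nhds hpV] with x hx hxV hxf
  have hz : inner ℝ n (x + (-(inner ℝ n (x - p) : ℝ) / inner ℝ n e) • e - p) = (0 : ℝ) := by
    rw [add_sub_right_comm, inner_add_right, real_inner_smul_right]
    field_simp
    ring
  have h0 := H.add_upDir_eq_zero hΩ.isOpen hxV hx.2 hxf (hx.1 hz)
  rw [div_eq_zero_iff, neg_eq_zero] at h0
  exact h0.resolve_right hne

theorem inner_wedge_sub_self (a σ p x : E3) :
    inner ℝ (wedge σ (p - a)) (x - a) = (inner ℝ (wedge σ (p - a)) (x - p) : ℝ) := by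
  have : x - a = (x - p) + (p - a) := by abel
  rw [this, inner_add_right, real_inner_comm (p - a) (wedge σ (p - a)), inner_wedge_self_right,
    add_zero]

theorem wedge_sub_ne_zero (hσ : ‖σ‖ = 1) {p : E3} (hp : radial a σ p ≠ 0) :
    wedge σ (p - a) ≠ 0 := by
  intro h
  have := wedge_wedge_left hσ a p
  rw [h, wedge_zero] at this
  exact hp (neg_eq_zero.1 this.symm)

/-- A connected piece of the graph that avoids the axis is contained in a plane through the axis. -/
theorem exists_plane_of_isPreconnected (hΩ : IsBoundedLipschitzDomain Ω) (hσ : ‖σ‖ = 1)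
    (H : IsChartOn Ω V Φ h) (hax : IsWeaklyTangent Ω V (fun _ => σ))
    (hrad : IsWeaklyTangent Ω V (radial a σ)) {B : Set E2} (hB : IsPreconnected B)
    (hne : B.Nonempty) (hBV : ∀ y ∈ B, graphPt Φ h y ∈ V)
    (hBa : ∀ y ∈ B, radial a σ (graphPt Φ h y) ≠ 0) :
    ∃ n : E3, n ≠ 0 ∧ inner ℝ n σ = (0 : ℝ) ∧ ∀ y ∈ B, inner ℝ n (graphPt Φ h y - a) = (0 : ℝ) := by
  obtain ⟨y₁, hy₁⟩ := hne
  have hg := continuous_graphPt Φ H.continuous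
  set m := radial a σ (graphPt Φ h y₁) with hm
  have hm0 : m ≠ 0 := hBa y₁ hy₁
  set n := wedge σ (graphPt Φ h y₁ - a) with hn
  set Z : Set E2 := {y | inner ℝ n (graphPt Φ h y - a) = (0 : ℝ)} with hZ
  have hZc : IsClosed Z := isClosed_eq (by fun_prop) continuous_const
  have hnσ : inner ℝ n σ = (0 : ℝ) := by rw [real_inner_comm]; exact inner_wedge_self_left _ _
  -- Connectedness argument: if the graph point over `y` is in the plane with normal `n`, its radial
  -- vector is a non-zero multiple of `m`. The plane that locally contains the boundary there is
  -- then the same plane.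
  have key : B ∩ Z ⊆ interior Z := by
    rintro y ⟨hyB, hyZ⟩
    rw [mem_interior_iff_mem_nhds]
    have h1 := eventually_mem_plane hΩ hσ H (hBV y hyB)
      (H.graphPt_mem_frontier hΩ.isOpen (hBV y hyB)) (hBa y hyB) hax hrad
    have h2 := h1.and (H.isOpen.mem_nhds (hBV y hyB))
    filter_upwards [hg.continuousAt.eventually h2] with z hz
    have h3 := hz.1 (H.graphPt_mem_frontier hΩ.isOpen hz.2)
    rw [← inner_wedge_sub_self] at h3
    have h4 : inner ℝ (wedge σ m) (radial a σ (graphPt Φ h y)) = (0 : ℝ) := by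
      have h5 : inner ℝ n (graphPt Φ h y - a) = (0 : ℝ) := hyZ
      rw [hm, wedge_radial, ← hn, radial, inner_sub_right, real_inner_smul_right, hnσ, h5]; ring
    have h6 := norm_sq_smul_eq hσ (inner_radial hσ _) h4
    rw [inner_radial hσ, mul_zero, zero_smul, add_zero] at h6
    set μ : ℝ := inner ℝ m (radial a σ (graphPt Φ h y))
    have hμ : μ ≠ 0 := by
      intro h0
      rw [h0, zero_smul] at h6
      exact (smul_ne_zero (pow_ne_zero 2 (norm_ne_zero_iff.2 hm0)) (hBa y hyB)) h6
    have h7 : (‖m‖ ^ 2) • wedge σ (graphPt Φ h y - a) = μ • n := by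
      rw [← wedge_radial, ← wedge_smul, h6, wedge_smul, wedge_radial]
    have h8 : μ * inner ℝ n (graphPt Φ h z - a) = 0 := by
      rw [← real_inner_smul_left, ← h7, real_inner_smul_left, h3, mul_zero]
    exact (mul_eq_zero.1 h8).resolve_left hμ
  have hsub : B ⊆ interior Z := by
    refine hB.subset_of_closure_inter_subset isOpen_interior ⟨y₁, hy₁, key ⟨hy₁, ?_⟩⟩ ?_
    · change inner ℝ n (graphPt Φ h y₁ - a) = (0 : ℝ)
      rw [hn, inner_wedge_sub_self]; simp
    · rintro y ⟨hyc, hyB⟩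
      exact key ⟨hyB, (closure_minimal interior_subset hZc) hyc⟩
  exact ⟨n, wedge_sub_ne_zero hσ hm0, hnσ, fun y hy => interior_subset (s := Z) (hsub hy)⟩

/-- Near a boundary point, the boundary is contained in two planes through the axis. -/
theorem eventually_mem_two_planes (hΩ : IsBoundedLipschitzDomain Ω) (hσ : ‖σ‖ = 1)
    (H : IsChartOn Ω V Φ h) {p : E3} (hpV : p ∈ V) (hp : p ∈ frontier Ω)
    (hax : IsWeaklyTangent Ω V (fun _ => σ)) (hrad : IsWeaklyTangent Ω V (radial a σ)) :
    ∃ n₁ n₂ : E3, (n₁ ≠ 0 ∧ inner ℝ n₁ σ = (0 : ℝ)) ∧ (n₂ ≠ 0 ∧ inner ℝ n₂ σ = (0 : ℝ)) ∧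
      ∀ᶠ x in 𝓝 p, x ∈ frontier Ω →
        inner ℝ n₁ (x - a) = (0 : ℝ) ∨ inner ℝ n₂ (x - a) = (0 : ℝ) := by
  by_cases hpa : radial a σ p = 0
  swap
  · have hn : wedge σ (p - a) ≠ 0 ∧ inner ℝ (wedge σ (p - a)) σ = (0 : ℝ) :=
      ⟨wedge_sub_ne_zero hσ hpa, by rw [real_inner_comm]; exact inner_wedge_self_left _ _⟩
    refine ⟨_, _, hn, hn, ?_⟩
    filter_upwards [eventually_mem_plane hΩ hσ H hpV hp hpa hax hrad] with x hx hxf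
    left
    rw [inner_wedge_sub_self, hx hxf]
  have hg := continuous_graphPt Φ H.continuous
  set y₀ := chartProj Φ p with hy₀
  have hpg : p = graphPt Φ h y₀ := H.eq_graphPt hΩ.isOpen hpV hp
  -- Here `p` is on the axis. The shadow of the axis in the base plane lies on the line through `y₀`
  -- orthogonal to `e`. Over each of the two open half discs cut off by this line the graph avoids
  -- the axis, and the half disc is convex, hence carries a single plane.
  obtain ⟨e, he0, he⟩ : ∃ e : E2, e ≠ 0 ∧
      inner ℝ e (planeProj (Φ.linearIsometryEquiv σ)) = (0 : ℝ) := by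
    set w := planeProj (Φ.linearIsometryEquiv σ)
    by_cases hw : w = 0
    · exact ⟨EuclideanSpace.single 0 1, by simp, by simp [hw]⟩
    · refine ⟨!₂[-w 1, w 0], fun h0 => hw ?_, by rw [E2.inner_eq]; simp; ring⟩
      have h1 := congrArg (fun v : E2 => v 0) h0
      have h2 := congrArg (fun v : E2 => v 1) h0
      simp at h1 h2
      apply E2.ext <;> simp [h1, h2]
  have hoff : ∀ y, inner ℝ e (y - y₀) ≠ (0 : ℝ) → radial a σ (graphPt Φ h y) ≠ 0 := by
    intro y hy h0
    apply hy
    have h1 : graphPt Φ h y = p +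
        ((inner ℝ σ (graphPt Φ h y - a) : ℝ) - inner ℝ σ (p - a)) • σ := by
      rw [radial, sub_eq_zero] at h0 hpa
      rw [sub_smul, ← h0, ← hpa]; abel
    have h2 : y - y₀ = ((inner ℝ σ (graphPt Φ h y - a) : ℝ) - inner ℝ σ (p - a)) •
        planeProj (Φ.linearIsometryEquiv σ) := by
      conv_lhs => rw [← chartProj_graphPt Φ h y, hy₀, h1]
      rw [chartProj, chartProj, apply_add, map_add, map_smul, map_smul, add_sub_cancel_left]
    rw [h2, real_inner_smul_right, he, mul_zero]
  obtain ⟨ρ, hρ, hball⟩ := Metric.mem_nhds_iff.1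
    (hg.continuousAt.eventually_mem (hpg ▸ H.isOpen.mem_nhds hpV : V ∈ 𝓝 (graphPt Φ h y₀)))
  have half : ∀ e : E2, e ≠ 0 →
      (∀ y, inner ℝ e (y - y₀) ≠ (0 : ℝ) → radial a σ (graphPt Φ h y) ≠ 0) →
      ∃ n : E3, n ≠ 0 ∧ inner ℝ n σ = (0 : ℝ) ∧ ∀ y ∈ Metric.ball y₀ ρ, 0 ≤ (inner ℝ e (y - y₀) : ℝ) →
        inner ℝ n (graphPt Φ h y - a) = (0 : ℝ) := by
    intro e he0 hoff
    have he1 : 0 < ‖e‖ := norm_pos_iff.2 he0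
    set B : Set E2 := Metric.ball y₀ ρ ∩ {y | 0 < (inner ℝ e (y - y₀) : ℝ)} with hB
    have hlim : ∀ y ∈ Metric.ball y₀ ρ, 0 ≤ (inner ℝ e (y - y₀) : ℝ) →
        ∀ᶠ t : ℝ in 𝓝[>] 0, y + t • e ∈ B := by
      intro y hy hye
      have hc : Continuous fun t : ℝ => y + t • e := by fun_prop
      have ht : Tendsto (fun t : ℝ => y + t • e) (𝓝[>] 0) (𝓝 y) := by
        simpa using (hc.tendsto 0).mono_left nhdsWithin_le_nhds
      filter_upwards [ht.eventually_mem (Metric.isOpen_ball.mem_nhds hy), self_mem_nhdsWithin]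
        with t ht1 ht2
      refine ⟨ht1, ?_⟩
      have : (0 : ℝ) < t := ht2
      rw [mem_ofPred_eq, add_sub_right_comm, inner_add_right, real_inner_smul_right,
        real_inner_self_eq_norm_sq]
      positivity
    have hBconv : Convex ℝ B := by
      refine (convex_ball y₀ ρ).inter ?_
      have : {y : E2 | 0 < (inner ℝ e (y - y₀) : ℝ)} = {y | inner ℝ e y₀ < (innerSL ℝ e) y} := by
        ext y; simp [inner_sub_right]
      rw [this]
      exact convex_halfSpace_gt (innerSL ℝ e).isLinear _
    have hBne : B.Nonempty := by
      obtain ⟨t, ht⟩ := (hlim y₀ (Metric.mem_ball_self hρ) (by simp)).exists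
      exact ⟨_, ht⟩
    obtain ⟨n, hn0, hnσ, hn⟩ := exists_plane_of_isPreconnected hΩ hσ H hax hrad
      hBconv.isPreconnected hBne (fun y hy => hball hy.1) (fun y hy => hoff y (ne_of_gt hy.2))
    refine ⟨n, hn0, hnσ, fun y hy hye => ?_⟩
    -- Points over the dividing line are limits from inside the half disc.
    have hc : Continuous fun t : ℝ => (inner ℝ n (graphPt Φ h (y + t • e) - a) : ℝ) := by fun_prop
    have ht : Tendsto (fun t : ℝ => (inner ℝ n (graphPt Φ h (y + t • e) - a) : ℝ)) (𝓝[>] 0)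
        (𝓝 (inner ℝ n (graphPt Φ h y - a))) := by
      simpa using (hc.tendsto 0).mono_left nhdsWithin_le_nhds
    refine tendsto_nhds_unique_of_eventuallyEq ht tendsto_const_nhds ?_
    filter_upwards [hlim y hy hye] with t ht using hn _ ht
  obtain ⟨n₁, hn₁, hn₁σ, h₁⟩ := half e he0 hoff
  obtain ⟨n₂, hn₂, hn₂σ, h₂⟩ := half (-e) (neg_ne_zero.2 he0) fun y hy => hoff y (by
    rwa [inner_neg_left, neg_ne_zero] at hy)
  refine ⟨n₁, n₂, ⟨hn₁, hn₁σ⟩, ⟨hn₂, hn₂σ⟩, ?_⟩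
  filter_upwards [H.isOpen.mem_nhds hpV,
    (continuous_chartProj Φ).continuousAt.eventually_mem (Metric.ball_mem_nhds y₀ hρ)] with x hxV hxb hxf
  rw [H.eq_graphPt hΩ.isOpen hxV hxf]
  rcases le_total 0 (inner ℝ e (chartProj Φ x - y₀) : ℝ) with hs | hs
  · exact Or.inl (h₁ _ hxb hs)
  · exact Or.inr (h₂ _ hxb (by rw [inner_neg_left]; linarith))

end Planes

/-! ### Vanishing of ⟨σ, b⟩ and the countable family of planes. -/

/-- The plane through `a` with normal vector `n`. -/
def normalPlane (a n : E3) : AffineSubspace ℝ E3 := AffineSubspace.mk' a (ℝ ∙ n)ᗮ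

theorem mem_normalPlane {a n x : E3} : x ∈ normalPlane a n ↔ inner ℝ n (x - a) = (0 : ℝ) := by
  rw [normalPlane, AffineSubspace.mem_mk', vsub_eq_sub,
    Submodule.mem_orthogonal_singleton_iff_inner_right]

theorem finrank_direction_normalPlane {a n : E3} (hn : n ≠ 0) :
    Module.finrank ℝ (normalPlane a n).direction = 2 := by
  rw [normalPlane, AffineSubspace.direction_mk']
  have : Fact (Module.finrank ℝ E3 = 2 + 1) := ⟨by simp⟩
  exact Submodule.finrank_orthogonal_span_singleton hn

theorem axisLine_subset_normalPlane {a n σ : E3} (hn : inner ℝ n σ = (0 : ℝ)) :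
    axisLine a σ ⊆ (normalPlane a n : Set E3) := by
  rintro _ ⟨t, rfl⟩
  rw [SetLike.mem_coe, mem_normalPlane, add_sub_cancel_right, real_inner_smul_right, hn, mul_zero]

theorem inner_eq_zero_of_memH1tn {Ω Γt : Set E3} (hΩ : IsBoundedLipschitzDomain Ω)
    (hΓt_open : ∃ U : Set E3, IsOpen U ∧ Γt = U ∩ frontier Ω) (hne : Γt ≠ ∅) {ω : ℝ} (hω : ω ≠ 0)
    {σ b : E3} (hσ : ‖σ‖ = 1) (hmem : MemH1tn Ω Γt (fun x => ω • wedge σ x + b)) :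
    inner ℝ σ b = (0 : ℝ) := by
  obtain ⟨U, hU, rfl⟩ := hΓt_open
  obtain ⟨p, hpU, hp⟩ := nonempty_iff_ne_empty.2 hne
  obtain ⟨Φ, h, δ, hδ, hball, H⟩ := hΩ.exists_isChartOn_of_mem_inter hU hpU hp
  by_contra hc
  have hw := hmem.isWeaklyTangent_wedge hΩ (contDiff_rigid ω σ b) H
    (inter_subset_inter_left _ hball)
  exact H.not_forall_isWeaklyTangent_const hΩ hp hδ (isWeaklyTangent_const hω hσ hc hw _)

/-- Each point of Γ_t has a neighbourhood with two planes; by Lindelöf, countably many of these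
neighbourhoods cover Γ_t. The local bound holds because each point lies in one of the chosen
neighbourhoods. -/
theorem exists_countable_planes {Ω Γt : Set E3} (hΩ : IsBoundedLipschitzDomain Ω)
    (hΓt_open : ∃ U : Set E3, IsOpen U ∧ Γt = U ∩ frontier Ω) {ω : ℝ} (hω : ω ≠ 0)
    {σ b : E3} (hσ : ‖σ‖ = 1) (hmem : MemH1tn Ω Γt (fun x => ω • wedge σ x + b)) :
    ∃ planes : Set (AffineSubspace ℝ E3), planes.Countable ∧
      (∀ P ∈ planes, Module.finrank ℝ P.direction = 2 ∧
        axisLine ((1 / ω) • wedge σ b) σ ⊆ (P : Set E3)) ∧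
      Γt ⊆ (⋃ P ∈ planes, (P : Set E3)) ∧
      ∀ p ∈ Γt, ∃ U ∈ 𝓝 p, ∃ P ∈ planes, ∃ Q ∈ planes, Γt ∩ U ⊆ (P : Set E3) ∪ (Q : Set E3) := by
  obtain ⟨U, hU, rfl⟩ := hΓt_open
  set a : E3 := (1 / ω) • wedge σ b
  have hloc : ∀ p : E3, ∃ n₁ n₂ : E3, ∃ W : Set E3, p ∈ U ∩ frontier Ω →
      (n₁ ≠ 0 ∧ inner ℝ n₁ σ = (0 : ℝ)) ∧ (n₂ ≠ 0 ∧ inner ℝ n₂ σ = (0 : ℝ)) ∧ IsOpen W ∧ p ∈ W ∧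
      (U ∩ frontier Ω) ∩ W ⊆ (normalPlane a n₁ : Set E3) ∪ (normalPlane a n₂ : Set E3) := by
    intro p
    by_cases hp : p ∈ U ∩ frontier Ω
    · obtain ⟨Φ, h, δ, hδ, hball, H⟩ := hΩ.exists_isChartOn_of_mem_inter hU hp.1 hp.2
      have hw := hmem.isWeaklyTangent_wedge hΩ (contDiff_rigid ω σ b) H
        (inter_subset_inter_left _ hball)
      obtain ⟨n₁, n₂, h₁, h₂, hev⟩ := eventually_mem_two_planes hΩ hσ H (Metric.mem_ball_self hδ)
        hp.2 (isWeaklyTangent_axis hω hw) (isWeaklyTangent_radial hω hσ hw)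
      obtain ⟨W, hWsub, hWo, hpW⟩ := mem_nhds_iff.1 hev
      refine ⟨n₁, n₂, W, fun _ => ⟨h₁, h₂, hWo, hpW, ?_⟩⟩
      rintro x ⟨⟨-, hxf⟩, hxW⟩
      exact (hWsub hxW hxf).imp mem_normalPlane.2 mem_normalPlane.2
    · exact ⟨0, 0, ∅, fun h => absurd h hp⟩
  choose n₁ n₂ W hW using hloc
  obtain ⟨t, htsub, htc, htcov⟩ := TopologicalSpace.countable_cover_nhdsWithin
    (s := U ∩ frontier Ω) (f := W)
    fun p hp => mem_nhdsWithin_of_mem_nhds ((hW p hp).2.2.1.mem_nhds (hW p hp).2.2.2.1)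
  refine ⟨(fun p => normalPlane a (n₁ p)) '' t ∪ (fun p => normalPlane a (n₂ p)) '' t,
    (htc.image _).union (htc.image _), ?_, ?_, ?_⟩
  · rintro P (⟨p, hp, rfl⟩ | ⟨p, hp, rfl⟩)
    · have := (hW p (htsub hp)).1
      exact ⟨finrank_direction_normalPlane this.1, axisLine_subset_normalPlane this.2⟩
    · have := (hW p (htsub hp)).2.1
      exact ⟨finrank_direction_normalPlane this.1, axisLine_subset_normalPlane this.2⟩
  · intro x hx
    obtain ⟨p, hp, hxp⟩ := mem_iUnion₂.1 (htcov hx)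
    rcases (hW p (htsub hp)).2.2.2.2 ⟨hx, hxp⟩ with h | h
    · exact mem_iUnion₂.2 ⟨_, Or.inl ⟨p, hp, rfl⟩, h⟩
    · exact mem_iUnion₂.2 ⟨_, Or.inr ⟨p, hp, rfl⟩, h⟩
  · intro x hx
    obtain ⟨p, hp, hxp⟩ := mem_iUnion₂.1 (htcov hx)
    exact ⟨W p, (hW p (htsub hp)).2.2.1.mem_nhds hxp, _, Or.inl ⟨p, hp, rfl⟩, _,
      Or.inr ⟨p, hp, rfl⟩, (hW p (htsub hp)).2.2.2.2⟩

/-! ### Gluing curves -/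

theorem LocallyLipschitz.smul_of_lipschitz {χ : ℝ → ℝ} {c : ℝ → E3} {L K : ℝ≥0}
    (hχ : LipschitzWith L χ) (hc : LipschitzWith K c) : LocallyLipschitz fun t => χ t • c t := by
  intro t₀
  obtain ⟨A, hA⟩ := (isCompact_closedBall t₀ 1).exists_bound_of_continuousOn
    hχ.continuous.continuousOn
  obtain ⟨B, hB⟩ := (isCompact_closedBall t₀ 1).exists_bound_of_continuousOn
    hc.continuous.continuousOn
  have ht₀ : t₀ ∈ Metric.closedBall t₀ 1 := Metric.mem_closedBall_self zero_le_one
  have hA0 : 0 ≤ A := (norm_nonneg _).trans (hA t₀ ht₀)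
  have hB0 : 0 ≤ B := (norm_nonneg _).trans (hB t₀ ht₀)
  lift A to ℝ≥0 using hA0
  lift B to ℝ≥0 using hB0
  refine ⟨A * K + L * B, _, Metric.closedBall_mem_nhds t₀ one_pos,
    LipschitzOnWith.of_dist_le_mul fun s hs t ht => ?_⟩
  have h1 := hc.dist_le_mul s t
  have h2 := hχ.dist_le_mul s t
  rw [dist_eq_norm] at h1 h2 ⊢
  have h3 : χ s • c s - χ t • c t = χ s • (c s - c t) + (χ s - χ t) • c t := by module
  rw [h3]
  calc ‖χ s • (c s - c t) + (χ s - χ t) • c t‖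
      ≤ ‖χ s‖ * ‖c s - c t‖ + ‖χ s - χ t‖ * ‖c t‖ := by
        rw [← norm_smul, ← norm_smul]; exact norm_add_le _ _
    _ ≤ A * (K * dist s t) + (L * dist s t) * B := by
        gcongr
        · exact hA s hs
        · exact hB t ht
    _ = _ := by push_cast; ring

theorem LocallyLipschitz.finset_sum {ι : Type*} (s : Finset ι) {f : ι → ℝ → E3}
    (hf : ∀ i ∈ s, LocallyLipschitz (f i)) : LocallyLipschitz fun t => ∑ i ∈ s, f i t := by
  classical
  induction s using Finset.induction_on with
  | empty => simpa using LocallyLipschitz.const (0 : E3)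
  | insert i s hi ih =>
    simp only [Finset.sum_insert hi]
    exact (hf i (Finset.mem_insert_self i s)).add (ih fun j hj => hf j (Finset.mem_insert_of_mem hj))

/-- Countably many Lipschitz arcs are contained in one locally Lipschitz curve. -/
theorem exists_locallyLipschitz_of_forall_lipschitz {c : ℕ → ℝ → E3}
    (hc : ∀ n, ∃ K, LipschitzWith K (c n)) :
    ∃ γ : ℝ → E3, LocallyLipschitz γ ∧ ∀ n, ∀ s ∈ Icc (-1 : ℝ) 1, ∃ t, γ t = c n s := by
  -- A cut-off equal to 1 on [-1, 1] and to 0 outside (-2, 2). Translates by multiples of 4 do not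
  -- overlap, so arc `n` is run through unchanged on [4n - 1, 4n + 1].
  set χ : ℝ → ℝ := fun t => max 0 (min 1 (2 - |t|)) with hχdef
  have hχ : LipschitzWith 1 χ := by
    have h1 : LipschitzWith 1 fun t : ℝ => 2 - |t| := LipschitzWith.of_dist_le_mul fun s t => by
      rw [Real.dist_eq, Real.dist_eq, sub_sub_sub_cancel_left, NNReal.coe_one, one_mul, abs_sub_comm s t]
      exact abs_abs_sub_abs_le t s
    exact (h1.const_min 1).const_max 0
  have hχ1 : ∀ t, |t| ≤ 1 → χ t = 1 := fun t ht => by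
    simp only [hχdef]
    rw [min_eq_left (by linarith), max_eq_right zero_le_one]
  have hχ0 : ∀ t, 2 ≤ |t| → χ t = 0 := fun t ht => by
    simp only [hχdef]
    exact max_eq_left ((min_le_right _ _).trans (by linarith))
  set F : ℕ → ℝ → E3 := fun n t => χ (t - 4 * n) • c n (t - 4 * n) with hF
  have hFl : ∀ n, LocallyLipschitz (F n) := fun n => by
    obtain ⟨K, hK⟩ := hc n
    have hs : LipschitzWith 1 fun t : ℝ => t - 4 * n := LipschitzWith.of_dist_le_mul fun s t => by
      simp
    exact LocallyLipschitz.smul_of_lipschitz (hχ.comp hs) (hK.comp hs)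
  -- For `n ≥ N t` one has `n ≥ |t| + 1`, so `4n` is at distance at least 2 from `t`: the sum is
  -- locally finite.
  set N : ℝ → ℕ := fun t => ⌊|t|⌋₊ + 2 with hN
  have hF0 : ∀ t n, N t ≤ n → F n t = 0 := fun t n hn => by
    have h1 : |t| + 1 ≤ n := by
      have := Nat.lt_floor_add_one |t|
      have h2 : ((⌊|t|⌋₊ + 2 : ℕ) : ℝ) ≤ n := by exact_mod_cast hn
      push_cast at h2
      linarith
    have h2 : 2 ≤ |t - 4 * n| := by
      rw [abs_sub_comm]
      refine le_trans ?_ (le_abs_self _)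
      linarith [le_abs_self t, abs_nonneg t]
    simp only [hF]
    rw [hχ0 _ h2, zero_smul]
  set γ : ℝ → E3 := fun t => ∑ n ∈ Finset.range (N t), F n t with hγ
  have hγM : ∀ t M, N t ≤ M → γ t = ∑ n ∈ Finset.range M, F n t := fun t M hM =>
    Finset.sum_subset (Finset.range_mono hM) fun n _ hn => hF0 t n (by simpa using hn)
  refine ⟨γ, fun t₀ => ?_, fun n s hs => ⟨4 * n + s, ?_⟩⟩
  · set M : ℕ := ⌊|t₀| + 1⌋₊ + 2
    obtain ⟨K, U, hU, hK⟩ := LocallyLipschitz.finset_sum (Finset.range M) (fun n _ => hFl n) t₀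
    refine ⟨K, U ∩ Metric.ball t₀ 1, inter_mem hU (Metric.ball_mem_nhds t₀ one_pos), ?_⟩
    have heq : ∀ t ∈ U ∩ Metric.ball t₀ 1, γ t = ∑ n ∈ Finset.range M, F n t := by
      rintro t ⟨-, ht⟩
      refine hγM t M (Nat.add_le_add_right (Nat.floor_le_floor ?_) 2)
      rw [Metric.mem_ball, Real.dist_eq] at ht
      have := abs_sub_abs_le_abs_sub t t₀
      linarith
    intro s hs t ht
    rw [heq s hs, heq t ht]
    exact hK hs.1 ht.1
  · have hs1 : |s| ≤ 1 := abs_le.2 hs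
    rw [hγM _ (max (N (4 * n + s)) (n + 1)) (le_max_left _ _),
      Finset.sum_eq_single_of_mem n (Finset.mem_range.2 (lt_of_lt_of_le n.lt_succ_self (le_max_right _ _)))]
    · simp only [hF, add_sub_cancel_left]
      rw [hχ1 s hs1, one_smul]
    · intro k _ hk
      simp only [hF]
      rw [hχ0, zero_smul]
      have h1 : (1 : ℝ) ≤ |(n : ℝ) - k| := by
        have : (1 : ℤ) ≤ |(n : ℤ) - k| := Int.one_le_abs (sub_ne_zero.2 (by exact_mod_cast hk.symm))
        exact_mod_cast this
      have h2 : 4 * (n : ℝ) + s - 4 * k = 4 * ((n : ℝ) - k) - (-s) := by ring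
      have h3 := abs_sub_abs_le_abs_sub (4 * ((n : ℝ) - k)) (-s)
      rw [abs_mul, abs_neg, abs_of_pos (by norm_num : (0 : ℝ) < 4)] at h3
      rw [h2]
      linarith

/-! ### Rotations -/

section Rotation

variable {a σ : E3}

theorem norm_sq_smul_add_smul_wedge (hσ : ‖σ‖ = 1) {m : E3} (hm : inner ℝ σ m = (0 : ℝ)) (c d : ℝ) :
    ‖c • m + d • wedge σ m‖ ^ 2 = (c ^ 2 + d ^ 2) * ‖m‖ ^ 2 := by
  have h1 := E3.sq_sum_eq_one hσ
  rw [← real_inner_self_eq_norm_sq, ← real_inner_self_eq_norm_sq, E3.inner_eq, E3.inner_eq]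
  rw [E3.inner_eq] at hm
  simp only [PiLp.add_apply, PiLp.smul_apply, smul_eq_mul, wedge_zero_coord, wedge_one_coord,
    wedge_two_coord]
  linear_combination (d ^ 2 * (m 0 ^ 2 + m 1 ^ 2 + m 2 ^ 2)) * h1 -
    d ^ 2 * (σ 0 * m 0 + σ 1 * m 1 + σ 2 * m 2) * hm

theorem norm_sq_rotAbout_sub (hσ : ‖σ‖ = 1) (x : E3) (θ : ℝ) :
    ‖rotAbout a σ θ x - x‖ ^ 2 = 2 * (1 - Real.cos θ) * ‖radial a σ x‖ ^ 2 := by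
  have h1 : rotAbout a σ θ x - x = (Real.cos θ - 1) • radial a σ x +
      Real.sin θ • wedge σ (radial a σ x) := by
    rw [rotAbout_eq, wedge_radial]; abel
  rw [h1, norm_sq_smul_add_smul_wedge hσ (inner_radial hσ x)]
  linear_combination ‖radial a σ x‖ ^ 2 * Real.sin_sq_add_cos_sq θ

/-- Chords of an orbit increase with the angle, up to `π`. -/
theorem norm_rotAbout_sub_le (hσ : ‖σ‖ = 1) (x : E3) {s θ : ℝ} (hθ : |θ| ≤ Real.pi)
    (hs : s ∈ uIcc 0 θ) : ‖rotAbout a σ s x - x‖ ≤ ‖rotAbout a σ θ x - x‖ := by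
  have h1 : |s| ≤ |θ| := by simpa using abs_sub_left_of_mem_uIcc hs
  refine le_of_sq_le_sq ?_ (norm_nonneg _)
  rw [norm_sq_rotAbout_sub hσ, norm_sq_rotAbout_sub hσ]
  have h2 := Real.cos_le_cos_of_nonneg_of_le_pi (abs_nonneg s) hθ h1
  rw [Real.cos_abs, Real.cos_abs] at h2
  gcongr

theorem exists_abs_le_pi_rotAbout_eq (a σ x : E3) (θ : ℝ) :
    ∃ θ', |θ'| ≤ Real.pi ∧ rotAbout a σ θ' x = rotAbout a σ θ x := by
  have h1 := toIocMod_mem_Ioc Real.two_pi_pos (-Real.pi) θ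
  have h2 := toIocMod_add_toIocDiv_zsmul Real.two_pi_pos (-Real.pi) θ
  set θ' := toIocMod Real.two_pi_pos (-Real.pi) θ
  refine ⟨θ', abs_le.2 ⟨h1.1.le, by linarith [h1.2]⟩, ?_⟩
  rw [zsmul_eq_mul] at h2
  rw [rotAbout_eq, rotAbout_eq, ← h2, Real.cos_add_int_mul_two_pi, Real.sin_add_int_mul_two_pi]

theorem rotAbout_add (hσ : ‖σ‖ = 1) (s t : ℝ) (x : E3) :
    rotAbout a σ (s + t) x = rotAbout a σ s (rotAbout a σ t x) :=
  (isSmoothFlow_rotation hσ).add s t x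

theorem continuous_rotAbout_left (a σ x : E3) : Continuous fun θ => rotAbout a σ θ x := by
  simp only [rotAbout_eq]; fun_prop

end Rotation

/-! ### Local axisymmetry of the components of Γ_n. -/

/-- Near every boundary point in the set `N`, there is a ball on which `N` is the boundary, where
the boundary is a graph and the rotation field about the line `a + ℝ σ` is weakly tangent. -/
def IsRotationTangent (Ω N : Set E3) (a σ : E3) : Prop :=
  ∀ p ∈ N, ∃ (Φ : E3 ≃ᵃⁱ[ℝ] E3) (h : E2 → ℝ) (δ : ℝ), 0 < δ ∧
    Metric.ball p δ ∩ frontier Ω ⊆ N ∧ IsChartOn Ω (Metric.ball p δ) Φ h ∧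
    IsWeaklyTangent Ω (Metric.ball p δ) (fun x => wedge σ (x - a))

/-- The orthogonality of σ and `b`, won near Γ_t, is used here: it makes `r` equal to ω times the
rotation field. -/
theorem isRotationTangent_normalPart {Ω Γt : Set E3} (hΩ : IsBoundedLipschitzDomain Ω) {ω : ℝ}
    (hω : ω ≠ 0) {σ b : E3} (hσ : ‖σ‖ = 1) (hc : inner ℝ σ b = (0 : ℝ))
    (hmem : MemH1tn Ω Γt (fun x => ω • wedge σ x + b)) :
    IsRotationTangent Ω (normalPart Ω Γt) ((1 / ω) • wedge σ b) σ := by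
  intro p hp
  obtain ⟨Φ, h, δ, hδ, hball, H⟩ := hΩ.exists_isChartOn_of_mem_inter
    isClosed_closure.isOpen_compl (U := (closure Γt)ᶜ) hp.2 hp.1
  have hsub : Metric.ball p δ ∩ frontier Ω ⊆ normalPart Ω Γt := fun x hx => ⟨hx.2, hball hx.1⟩
  refine ⟨Φ, h, δ, hδ, hsub, H, ?_⟩
  have h1 := (hmem.isWeaklyTangent_self hΩ (contDiff_rigid ω σ b) H hsub).smul
    (contDiff_const (c := ω⁻¹))
  convert h1 using 2 with x
  rw [rigid_eq hω hσ, hc, zero_smul, add_zero, smul_smul, inv_mul_cancel₀ hω, one_smul]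

section NormalPart

variable {Ω N V : Set E3} {Φ : E3 ≃ᵃⁱ[ℝ] E3} {h : E2 → ℝ} {a σ : E3}

theorem rotAbout_mem_frontier (hΩ : IsBoundedLipschitzDomain Ω) (hσ : ‖σ‖ = 1) (hV : IsOpen V)
    (hw : IsWeaklyTangent Ω V (fun x => wedge σ (x - a))) {x : E3} (hx : x ∈ frontier Ω) {T : ℝ}
    (hxV : ∀ s ∈ uIcc 0 T, rotAbout a σ s x ∈ V) : rotAbout a σ T x ∈ frontier Ω :=
  (isSmoothFlow_rotation hσ).mem_frontier hΩ.isOpen hΩ.isBounded hΩ.interior_closure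
    (((contDiff_wedge σ).comp (contDiff_id.sub contDiff_const)).differentiable (by simp))
    (dvg_wedge_sub a σ) hV hw hx hxV

/-- The connected components of the rotation-invariant part of the boundary are locally
axisymmetric. -/
theorem IsRotationTangent.exists_isAxisymmetric (hN : IsRotationTangent Ω N a σ)
    (hNΩ : N ⊆ frontier Ω) (hΩ : IsBoundedLipschitzDomain Ω) (hσ : ‖σ‖ = 1) {p q : E3}
    (hp : p ∈ connectedComponentIn N q) :
    ∃ U ∈ 𝓝 p, ∃ A : Set E3, IsAxisymmetric a σ A ∧
      connectedComponentIn N q ∩ U = A ∩ U := by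
  obtain ⟨Φ, h, δ, hδ, hsub, H, hw⟩ := hN p (connectedComponentIn_subset N q hp)
  set C := connectedComponentIn N q with hC
  -- Two points of `U` are less than 2δ/3 apart. Arc points are no farther from `y` than the end
  -- point is, so the whole arc stays within δ of `p`.
  set U := Metric.ball p (δ / 3) with hU
  refine ⟨U, Metric.ball_mem_nhds p (by positivity),
    {z | ∃ θ : ℝ, ∃ y ∈ C ∩ U, z = rotAbout a σ θ y}, ?_, ?_⟩
  · rintro θ _ ⟨θ', y, hy, rfl⟩
    exact ⟨θ + θ', y, hy, (rotAbout_add hσ θ θ' y).symm⟩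
  · refine Subset.antisymm ?_ ?_
    · rintro x ⟨hxC, hxU⟩
      exact ⟨⟨0, x, ⟨hxC, hxU⟩, ((isSmoothFlow_rotation hσ).zero x).symm⟩, hxU⟩
    · rintro _ ⟨⟨θ, y, ⟨hyC, hyU⟩, rfl⟩, hzU⟩
      refine ⟨?_, hzU⟩
      -- Chords are monotone in the angle only up to `π`, so the shorter arc is taken.
      obtain ⟨θ', hθ', heq⟩ := exists_abs_le_pi_rotAbout_eq a σ y θ
      rw [← heq] at hzU ⊢
      have harc : ∀ s ∈ uIcc 0 θ', rotAbout a σ s y ∈ Metric.ball p δ := by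
        intro s hs
        have h1 := norm_rotAbout_sub_le (a := a) hσ y hθ' hs
        rw [hU, Metric.mem_ball] at hyU hzU
        rw [Metric.mem_ball]
        have h2 := dist_triangle (rotAbout a σ s y) y p
        have h3 := dist_triangle_right (rotAbout a σ θ' y) y p
        rw [← dist_eq_norm, ← dist_eq_norm] at h1
        linarith
      have hyN : y ∈ N := connectedComponentIn_subset N q hyC
      have harcN : (fun s => rotAbout a σ s y) '' uIcc 0 θ' ⊆ N := by
        rintro _ ⟨s, hs, rfl⟩
        refine hsub ⟨harc s hs, ?_⟩
        exact rotAbout_mem_frontier hΩ hσ Metric.isOpen_ball hw (hNΩ hyN) fun s' hs' =>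
          harc s' (uIcc_subset_uIcc_left hs hs')
      have hconn : IsPreconnected ((fun s => rotAbout a σ s y) '' uIcc 0 θ') :=
        isPreconnected_uIcc.image _ (continuous_rotAbout_left a σ y).continuousOn
      rw [hC, connectedComponentIn_eq hyC]
      exact hconn.subset_connectedComponentIn
        ⟨0, left_mem_uIcc, (isSmoothFlow_rotation hσ).zero y⟩ harcN ⟨θ', right_mem_uIcc, rfl⟩

end NormalPart

/-! ### Profile curves and the surface of revolution. -/

section Profile

variable {Ω N : Set E3} {Φ : E3 ≃ᵃⁱ[ℝ] E3} {h : E2 → ℝ} {a σ p : E3} {δ : ℝ}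

theorem E2.eq_inner_smul_perp {u v : E2} (hu : ‖u‖ = 1) (huv : inner ℝ u v = (0 : ℝ)) :
    v = (inner ℝ !₂[-u 1, u 0] v : ℝ) • !₂[-u 1, u 0] := by
  have h1 := EuclideanSpace.real_norm_sq_eq u
  rw [hu, Fin.sum_univ_two] at h1
  rw [E2.inner_eq] at huv
  rw [E2.inner_eq]
  apply E2.ext <;> simp
  · linear_combination u 0 * huv + v 0 * h1
  · linear_combination u 1 * huv + v 1 * h1

theorem E2.norm_perp {u : E2} (hu : ‖u‖ = 1) : ‖(!₂[-u 1, u 0] : E2)‖ = 1 := by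
  rw [← hu, EuclideanSpace.norm_eq, EuclideanSpace.norm_eq]
  simp [Fin.sum_univ_two, add_comm]

/-- If the orbits of the points near `p` cross a vertical plane, then the boundary near `p` is swept
out by its intersection with this plane, which is a Lipschitz curve. -/
theorem exists_lipschitz_profile_of_crossing (hΩ : IsBoundedLipschitzDomain Ω) (hσ : ‖σ‖ = 1)
    (H : IsChartOn Ω (Metric.ball p δ) Φ h)
    (hw : IsWeaklyTangent Ω (Metric.ball p δ) (fun x => wedge σ (x - a)))
    (hδ1 : δ ≤ 1) {u : E2} (hu : ‖u‖ = 1) {T₁ T₂ : ℝ} (hT₁ : T₁ ≤ 0) (hT₂ : 0 ≤ T₂)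
    (horb : ∀ s ∈ Icc T₁ T₂, rotAbout a σ s p ∈ Metric.ball p δ)
    (hcross : ∀ᶠ x in 𝓝 p, (inner ℝ u (chartProj Φ (rotAbout a σ T₁ x) - chartProj Φ p) : ℝ) *
      inner ℝ u (chartProj Φ (rotAbout a σ T₂ x) - chartProj Φ p) ≤ 0) :
    ∃ c : ℝ → E3, (∃ K, LipschitzWith K c) ∧ ∀ᶠ x in 𝓝 p, x ∈ frontier Ω →
      ∃ s ∈ Icc (-1 : ℝ) 1, ∃ θ : ℝ, x = rotAbout a σ θ (c s) := by
  obtain ⟨K, hK⟩ := H.lipschitz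
  obtain ⟨L, hL⟩ := lipschitz_graphPt Φ hK
  set d : E2 := !₂[-u 1, u 0] with hd
  -- The graph over the line through the base point of `p` orthogonal to `u`. As `d` is a unit
  -- vector and `δ ≤ 1`, the parameters needed lie in [-1, 1].
  refine ⟨fun s => graphPt Φ h (chartProj Φ p + s • d), ⟨_, hL.comp
    ((LipschitzWith.const (chartProj Φ p)).add
      (ContinuousLinearMap.toSpanSingleton ℝ d).lipschitz)⟩, ?_⟩
  filter_upwards [hcross, (isSmoothFlow_rotation hσ).eventually_forall_mem Metric.isOpen_ball
    isCompact_Icc horb] with x hx hxorb hxf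
  set f : ℝ → ℝ := fun t => inner ℝ u (chartProj Φ (rotAbout a σ t x) - chartProj Φ p) with hf
  have hfc : Continuous f :=
    continuous_const.inner (((continuous_chartProj Φ).comp
      (continuous_rotAbout_left a σ x)).sub continuous_const)
  have h0 : (0 : ℝ) ∈ uIcc (f T₁) (f T₂) := by
    rw [mem_uIcc]
    rcases mul_nonpos_iff.1 hx with h | h
    · exact Or.inr ⟨h.2, h.1⟩
    · exact Or.inl h
  -- The orbit of `x` changes sides of the line, so some rotated copy of `x` lies over it.
  obtain ⟨t, ht, hft⟩ := intermediate_value_uIcc (f := f) hfc.continuousOn h0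
  rw [uIcc_of_le (hT₁.trans hT₂)] at ht
  have hzV := hxorb t ht
  have hzf : rotAbout a σ t x ∈ frontier Ω :=
    rotAbout_mem_frontier hΩ hσ Metric.isOpen_ball hw hxf fun s hs => by
      refine hxorb s ?_
      rw [mem_uIcc] at hs
      rcases hs with hs | hs
      · exact ⟨hT₁.trans hs.1, hs.2.trans ht.2⟩
      · exact ⟨ht.1.trans hs.1, hs.2.trans hT₂⟩
  have hz := H.eq_graphPt hΩ.isOpen hzV hzf
  set z := rotAbout a σ t x with hzdef
  have hv := E2.eq_inner_smul_perp hu hft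
  refine ⟨inner ℝ d (chartProj Φ z - chartProj Φ p), ?_, -t, ?_⟩
  · rw [mem_Icc, ← abs_le]
    calc |(inner ℝ d (chartProj Φ z - chartProj Φ p) : ℝ)|
        ≤ ‖d‖ * ‖chartProj Φ z - chartProj Φ p‖ := abs_real_inner_le_norm _ _
      _ ≤ dist z p := by
          rw [hd, E2.norm_perp hu, one_mul, ← dist_eq_norm]
          simpa using (lipschitz_chartProj Φ).dist_le_mul z p
      _ ≤ 1 := (Metric.mem_ball.1 hzV).le.trans hδ1
  · rw [← hv, add_sub_cancel, ← hz]
    exact ((isSmoothFlow_rotation hσ).neg_apply t x).symm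

theorem chartProj_rotAbout (Φ : E3 ≃ᵃⁱ[ℝ] E3) (a σ x : E3) (t : ℝ) :
    chartProj Φ (rotAbout a σ t x) = chartProj Φ x +
      (Real.cos t - 1) • planeProj (Φ.linearIsometryEquiv (radial a σ x)) +
      Real.sin t • planeProj (Φ.linearIsometryEquiv (wedge σ (x - a))) := by
  rw [rotAbout_eq, chartProj, apply_add, apply_add]
  simp only [map_add, map_smul]
  rfl

theorem rotAbout_of_radial_eq_zero {x : E3} (hx : radial a σ x = 0) (t : ℝ) :
    rotAbout a σ t x = x := by
  rw [rotAbout_eq, ← wedge_radial, hx, wedge_zero]; simp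

theorem exists_norm_eq_one_inner_eq_zero (w : E2) : ∃ u : E2, ‖u‖ = 1 ∧ inner ℝ u w = (0 : ℝ) := by
  by_cases hw : w = 0
  · exact ⟨EuclideanSpace.single 0 1, by simp, by simp [hw]⟩
  · have hw' : ‖w‖ ≠ 0 := norm_ne_zero_iff.2 hw
    have h1 : ‖(‖w‖⁻¹ • w)‖ = 1 := by rw [norm_smul, norm_inv, norm_norm, inv_mul_cancel₀ hw']
    refine ⟨_, E2.norm_perp h1, ?_⟩
    rw [E2.inner_eq]; simp; ring

/-- The profile curve near a boundary point on the axis. -/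
theorem exists_lipschitz_profile_on_axis (hΩ : IsBoundedLipschitzDomain Ω) (hσ : ‖σ‖ = 1)
    (H : IsChartOn Ω (Metric.ball p δ) Φ h) (hδ : 0 < δ)
    (hw : IsWeaklyTangent Ω (Metric.ball p δ) (fun x => wedge σ (x - a)))
    (hδ1 : δ ≤ 1) (hpa : radial a σ p = 0) :
    ∃ c : ℝ → E3, (∃ K, LipschitzWith K c) ∧ ∀ᶠ x in 𝓝 p, x ∈ frontier Ω →
      ∃ s ∈ Icc (-1 : ℝ) 1, ∃ θ : ℝ, x = rotAbout a σ θ (c s) := by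
  obtain ⟨u, hu, huσ⟩ := exists_norm_eq_one_inner_eq_zero (planeProj (Φ.linearIsometryEquiv σ))
  -- A half turn reverses the radial vector, and `u` is orthogonal to the shadow of the axis, so the
  -- offset along `u` changes sign between the angles 0 and `π`.
  refine exists_lipschitz_profile_of_crossing hΩ hσ H hw hδ1 hu le_rfl Real.pi_pos.le
    (fun s _ => ?_) (Eventually.of_forall fun x => ?_)
  · rw [rotAbout_of_radial_eq_zero hpa]; exact Metric.mem_ball_self hδ
  · set M := planeProj (Φ.linearIsometryEquiv (radial a σ x)) with hM
    have h1 : x = p + (((inner ℝ σ (x - a) : ℝ) - inner ℝ σ (p - a)) • σ + radial a σ x) := by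
      have h2 : radial a σ x = radial a σ x - radial a σ p := by rw [hpa, sub_zero]
      rw [h2]; simp only [radial]; module
    have h2 : (inner ℝ u (chartProj Φ x - chartProj Φ p) : ℝ) = inner ℝ u M := by
      conv_lhs => rw [h1]
      rw [chartProj, chartProj, apply_add, map_add, add_sub_cancel_left, map_add, map_add, map_smul,
        map_smul, inner_add_right, real_inner_smul_right, huσ, mul_zero, zero_add]
    rw [chartProj_rotAbout, chartProj_rotAbout]
    simp only [Real.cos_zero, Real.sin_zero, Real.cos_pi, Real.sin_pi, sub_self, zero_smul, add_zero]
    rw [add_sub_right_comm, inner_add_right, real_inner_smul_right, h2, ← hM]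
    nlinarith [sq_nonneg (inner ℝ u M : ℝ)]

/-- Off the axis, the velocity of the rotation is not vertical. -/
theorem planeProj_velocity_ne_zero (hΩ : IsBoundedLipschitzDomain Ω) (hσ : ‖σ‖ = 1)
    (H : IsChartOn Ω (Metric.ball p δ) Φ h) (hδ : 0 < δ) (hp : p ∈ frontier Ω)
    (hw : IsWeaklyTangent Ω (Metric.ball p δ) (fun x => wedge σ (x - a)))
    (hpa : radial a σ p ≠ 0) : planeProj (Φ.linearIsometryEquiv (wedge σ (p - a))) ≠ 0 := by
  intro hN
  obtain ⟨K, hK⟩ := H.lipschitz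
  set v := Φ.linearIsometryEquiv (wedge σ (p - a)) with hv
  set m := Φ.linearIsometryEquiv (radial a σ p) with hm
  have hpV : p ∈ Metric.ball p δ := Metric.mem_ball_self hδ
  have hfr : ∀ᶠ t : ℝ in 𝓝[>] 0, rotAbout a σ t p ∈ Metric.ball p δ ∧
      rotAbout a σ t p ∈ frontier Ω := by
    have hc := (continuous_rotAbout_left a σ p).tendsto 0
    have h0 : rotAbout a σ 0 p = p := (isSmoothFlow_rotation hσ).zero p
    rw [h0] at hc
    obtain ⟨ε, hε, hball⟩ := Metric.mem_nhds_iff.1 (hc (Metric.ball_mem_nhds p hδ))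
    filter_upwards [Ioo_mem_nhdsGT hε] with t ht
    have hs : ∀ s ∈ uIcc 0 t, rotAbout a σ s p ∈ Metric.ball p δ := fun s hs => by
      rw [uIcc_of_le ht.1.le] at hs
      refine hball ?_
      rw [Metric.mem_ball, Real.dist_eq, sub_zero, abs_of_nonneg hs.1]
      exact lt_of_le_of_lt hs.2 ht.2
    exact ⟨hs t right_mem_uIcc, rotAbout_mem_frontier hΩ hσ Metric.isOpen_ball hw hp hs⟩
  -- With vertical velocity, the horizontal displacement along the orbit is of order t², and by the
  -- Lipschitz bound so is the vertical one. But the latter is `sin t · v₂` up to order t², which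
  -- leaves `|v₂| ≤ A t` as `t` tends to 0.
  set A : ℝ := K * ‖planeProj m‖ + |m 2| with hA
  have hbound : ∀ᶠ t : ℝ in 𝓝[>] 0, |v 2| ≤ A * t := by
    have h2 : Ioo (0 : ℝ) (Real.pi / 2) ∈ 𝓝[>] (0 : ℝ) := Ioo_mem_nhdsGT (by positivity)
    filter_upwards [hfr, h2] with t ht ht2
    have e1 := (H.mem_frontier_iff hΩ.isOpen ht.1).1 ht.2
    have e2 := (H.mem_frontier_iff hΩ.isOpen hpV).1 hp
    rw [chartProj_rotAbout, ← hv, ← hm, hN, smul_zero, add_zero] at e1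
    have e3 : Φ (rotAbout a σ t p) 2 = Φ p 2 + (Real.cos t - 1) * m 2 + Real.sin t * v 2 := by
      rw [rotAbout_eq, apply_add, apply_add]; simp [hm, hv]
    have e4 := hK.dist_le_mul (chartProj Φ p + (Real.cos t - 1) • planeProj m) (chartProj Φ p)
    rw [Real.dist_eq, ← e1, ← e2, e3, dist_eq_norm, add_sub_cancel_left, norm_smul,
      Real.norm_eq_abs] at e4
    have hcos : |Real.cos t - 1| ≤ t ^ 2 / 2 := by
      rw [abs_le]
      constructor
      · linarith [Real.one_sub_sq_div_two_le_cos (x := t)]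
      · linarith [Real.cos_le_one t, sq_nonneg t]
    have hsin : t / 2 ≤ Real.sin t := by
      have h3 := Real.mul_le_sin ht2.1.le ht2.2.le
      refine le_trans ?_ h3
      have : (1 : ℝ) / 2 ≤ 2 / Real.pi := by
        rw [div_le_div_iff₀ (by norm_num) Real.pi_pos]; linarith [Real.pi_le_four]
      nlinarith [ht2.1]
    have e5 : Real.sin t * |v 2| ≤ |Real.cos t - 1| * A := by
      have h3 : Real.sin t * v 2 = (Φ p 2 + (Real.cos t - 1) * m 2 + Real.sin t * v 2 - Φ p 2) -
          (Real.cos t - 1) * m 2 := by ring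
      have h4 : Real.sin t * |v 2| = |Real.sin t * v 2| := by
        rw [abs_mul, abs_of_nonneg (le_trans (by linarith [ht2.1]) hsin)]
      rw [h4, h3]
      refine (abs_sub _ _).trans ?_
      rw [abs_mul, hA]
      linarith
    have hA0 : 0 ≤ A := by positivity
    have e6 : t / 2 * |v 2| ≤ t ^ 2 / 2 * A :=
      (mul_le_mul_of_nonneg_right hsin (abs_nonneg _)).trans
        (e5.trans (mul_le_mul_of_nonneg_right hcos hA0))
    have h7 : 0 < t := ht2.1
    have e8 : t * |v 2| ≤ t * (A * t) := by linarith
    exact le_of_mul_le_mul_left e8 h7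
  have hlim : Tendsto (fun t : ℝ => A * t) (𝓝[>] 0) (𝓝 0) := by
    have : Continuous fun t : ℝ => A * t := by fun_prop
    simpa using (this.tendsto 0).mono_left nhdsWithin_le_nhds
  have hv2 : v 2 = 0 := abs_eq_zero.1 (le_antisymm (ge_of_tendsto hlim hbound) (abs_nonneg _))
  have hv0 : v = 0 := by
    rw [← planeEmb_add_vert v, hN, hv2]; simp
  exact wedge_sub_ne_zero hσ hpa (by simpa [hv] using hv0)

/-- The profile curve near a boundary point off the axis. -/
theorem exists_lipschitz_profile_off_axis (hΩ : IsBoundedLipschitzDomain Ω) (hσ : ‖σ‖ = 1)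
    (H : IsChartOn Ω (Metric.ball p δ) Φ h) (hδ : 0 < δ) (hp : p ∈ frontier Ω)
    (hw : IsWeaklyTangent Ω (Metric.ball p δ) (fun x => wedge σ (x - a)))
    (hδ1 : δ ≤ 1) (hpa : radial a σ p ≠ 0) :
    ∃ c : ℝ → E3, (∃ K, LipschitzWith K c) ∧ ∀ᶠ x in 𝓝 p, x ∈ frontier Ω →
      ∃ s ∈ Icc (-1 : ℝ) 1, ∃ θ : ℝ, x = rotAbout a σ θ (c s) := by
  have hN := planeProj_velocity_ne_zero hΩ hσ H hδ hp hw hpa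
  set v := planeProj (Φ.linearIsometryEquiv (wedge σ (p - a))) with hv
  set m := planeProj (Φ.linearIsometryEquiv (radial a σ p)) with hm
  have hv0 : 0 < ‖v‖ := norm_pos_iff.2 hN
  set u : E2 := ‖v‖⁻¹ • v with hu
  have hu1 : ‖u‖ = 1 := by rw [hu, norm_smul, norm_inv, norm_norm, inv_mul_cancel₀ hv0.ne']
  have huv : (inner ℝ u v : ℝ) = ‖v‖ := by
    rw [hu, real_inner_smul_left, real_inner_self_eq_norm_sq, sq, inv_mul_cancel_left₀ hv0.ne']
  -- The horizontal offset along the direction of motion. For `x = p` it has derivative `‖v‖ > 0` at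
  -- 0, hence opposite signs at `±ε/2`, and these strict signs persist for nearby `x`.
  set f : E3 → ℝ → ℝ := fun x t => inner ℝ u (chartProj Φ (rotAbout a σ t x) - chartProj Φ p) with hf
  have hfp : ∀ t, f p t = (Real.cos t - 1) * inner ℝ u m + Real.sin t * ‖v‖ := fun t => by
    simp only [hf]
    rw [chartProj_rotAbout, add_assoc, add_sub_cancel_left, inner_add_right, real_inner_smul_right,
      real_inner_smul_right, huv]
  have hder : HasDerivAt (f p) ‖v‖ 0 := by
    have h1 := (((Real.hasDerivAt_cos 0).sub_const 1).mul_const (inner ℝ u m : ℝ)).add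
      ((Real.hasDerivAt_sin 0).mul_const ‖v‖)
    rw [Real.sin_zero, neg_zero, zero_mul, Real.cos_zero, one_mul, zero_add] at h1
    refine h1.congr_of_eventuallyEq (Eventually.of_forall fun t => ?_)
    rw [hfp]; rfl
  have hf0 : f p 0 = 0 := by rw [hfp]; simp
  have hslope := (hasDerivAt_iff_tendsto_slope.1 hder).eventually_const_lt hv0
  have hc := (continuous_rotAbout_left a σ p).tendsto 0
  rw [(isSmoothFlow_rotation hσ).zero p] at hc
  have hboth := (eventually_nhdsWithin_iff.1 hslope).and
    (hc.eventually_mem (Metric.ball_mem_nhds p hδ))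
  obtain ⟨ε, hε, hball⟩ := Metric.mem_nhds_iff.1 hboth
  have hmem : ∀ s ∈ Icc (-(ε / 2)) (ε / 2), s ∈ Metric.ball (0 : ℝ) ε := fun s hs => by
    rw [Metric.mem_ball, Real.dist_eq, sub_zero]
    exact lt_of_le_of_lt (abs_le.2 hs) (by linarith)
  have hpos : 0 < f p (ε / 2) := by
    have h1 := (hball (hmem (ε / 2) ⟨by linarith, le_rfl⟩)).1 (by simp; positivity)
    rw [slope_def_field, hf0, sub_zero, sub_zero] at h1
    exact (div_pos_iff_of_pos_right (by positivity)).1 h1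
  have hneg : f p (-(ε / 2)) < 0 := by
    have h1 := (hball (hmem (-(ε / 2)) ⟨le_rfl, by linarith⟩)).1 (by simp; positivity)
    rw [slope_def_field, hf0, sub_zero, sub_zero, div_neg, ← neg_div] at h1
    exact neg_pos.1 ((div_pos_iff_of_pos_right (by positivity)).1 h1)
  have hfx : ∀ t, Continuous fun x => f x t := fun t =>
    continuous_const.inner (((continuous_chartProj Φ).comp
      ((isSmoothFlow_rotation hσ).continuous_right t)).sub continuous_const)
  refine exists_lipschitz_profile_of_crossing hΩ hσ H hw hδ1 hu1 (T₁ := -(ε / 2)) (T₂ := ε / 2)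
    (by linarith) (by linarith) (fun s hs => (hball (hmem s hs)).2) ?_
  filter_upwards [(hfx (-(ε / 2))).continuousAt.eventually_lt_const hneg,
    (hfx (ε / 2)).continuousAt.eventually_const_lt hpos] with x h1 h2
  exact mul_nonpos_of_nonpos_of_nonneg h1.le h2.le

/-- The rotation-invariant part of the boundary is contained in a surface of revolution. -/
theorem IsRotationTangent.exists_isSurfaceOfRevolution (hN : IsRotationTangent Ω N a σ)
    (hNΩ : N ⊆ frontier Ω) (hΩ : IsBoundedLipschitzDomain Ω) (hσ : ‖σ‖ = 1) (hne : N.Nonempty) :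
    ∃ S : Set E3, IsSurfaceOfRevolution a σ S ∧ N ⊆ S := by
  have hloc : ∀ p : E3, ∃ c : ℝ → E3, p ∈ N → (∃ K, LipschitzWith K c) ∧ ∀ᶠ x in 𝓝 p,
      x ∈ frontier Ω → ∃ s ∈ Icc (-1 : ℝ) 1, ∃ θ : ℝ, x = rotAbout a σ θ (c s) := by
    intro p
    by_cases hp : p ∈ N
    · obtain ⟨Φ, h, δ, hδ, -, H, hw⟩ := hN p hp
      have hsub : Metric.ball p (min δ 1) ⊆ Metric.ball p δ :=
        Metric.ball_subset_ball (min_le_left _ _)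
      have hδ' : 0 < min δ 1 := lt_min hδ one_pos
      have H' := H.mono Metric.isOpen_ball hsub
      by_cases hpa : radial a σ p = 0
      · obtain ⟨c, hc⟩ := exists_lipschitz_profile_on_axis hΩ hσ H' hδ' (hw.mono hsub)
          (min_le_right _ _) hpa
        exact ⟨c, fun _ => hc⟩
      · obtain ⟨c, hc⟩ := exists_lipschitz_profile_off_axis hΩ hσ H' hδ' (hNΩ hp) (hw.mono hsub)
          (min_le_right _ _) hpa
        exact ⟨c, fun _ => hc⟩
    · exact ⟨0, fun h => absurd h hp⟩
  choose c hc using hloc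
  obtain ⟨t, htsub, htc, htcov⟩ := TopologicalSpace.countable_cover_nhdsWithin
    (s := N) (f := fun p => {x | x ∈ frontier Ω → ∃ s ∈ Icc (-1 : ℝ) 1, ∃ θ : ℝ,
      x = rotAbout a σ θ (c p s)}) fun p hp => mem_nhdsWithin_of_mem_nhds (hc p hp).2
  -- Enumerating the arcs by the natural numbers requires at least one.
  have htne : t.Nonempty := by
    obtain ⟨q, hq⟩ := hne
    obtain ⟨p, hp, -⟩ := mem_iUnion₂.1 (htcov hq)
    exact ⟨p, hp⟩
  obtain ⟨e, rfl⟩ := htc.exists_eq_range htne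
  obtain ⟨γ, hγ, hγc⟩ := exists_locallyLipschitz_of_forall_lipschitz
    (c := fun n => c (e n)) fun n => (hc (e n) (htsub ⟨n, rfl⟩)).1
  refine ⟨_, ⟨γ, hγ, rfl⟩, fun x hx => ?_⟩
  obtain ⟨p, ⟨n, rfl⟩, hxp⟩ := mem_iUnion₂.1 (htcov hx)
  obtain ⟨s, hs, θ, hxs⟩ := hxp (hNΩ hx)
  obtain ⟨t, ht⟩ := hγc n s hs
  exact ⟨t, θ, by rw [ht]; exact hxs⟩

end Profile

end

/-! ### The main theorem. -/

theorem mainTheorem4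
    (Ω Γt : Set E3) (hΩ : IsBoundedLipschitzDomain Ω)
    (hΓt_open : ∃ U : Set E3, IsOpen U ∧ Γt = U ∩ frontier Ω)
    (hΓt_nonempty : Γt ≠ ∅) (hΓt_ne : Γt ≠ frontier Ω)
    (ω : ℝ) (σ b : E3) (hσ : ‖σ‖ = 1)
    (r : E3 → E3) (hr : ∀ x, r x = ω • wedge σ x + b)
    (hr_nonconst : ¬ ∃ c : E3, ∀ x, r x = c)
    (hr_mem : MemH1tn Ω Γt r) :
    inner ℝ σ b = 0 ∧
    (∃ planes : Set (AffineSubspace ℝ E3), planes.Countable ∧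
      (∀ P ∈ planes, Module.finrank ℝ P.direction = 2 ∧
        axisLine ((1 / ω) • wedge σ b) σ ⊆ (P : Set E3)) ∧
      Γt ⊆ (⋃ P ∈ planes, (P : Set E3)) ∧
      ∀ p ∈ Γt, ∃ U ∈ 𝓝 p, ∃ P ∈ planes, ∃ Q ∈ planes, Γt ∩ U ⊆ (P : Set E3) ∪ (Q : Set E3)) ∧
    ∀ q ∈ normalPart Ω Γt,
      (∃ S : Set E3, IsSurfaceOfRevolution ((1 / ω) • wedge σ b) σ S ∧
        connectedComponentIn (normalPart Ω Γt) q ⊆ S) ∧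
      ∀ p ∈ connectedComponentIn (normalPart Ω Γt) q, ∃ U ∈ 𝓝 p, ∃ A : Set E3,
        IsAxisymmetric ((1 / ω) • wedge σ b) σ A ∧
        connectedComponentIn (normalPart Ω Γt) q ∩ U = A ∩ U := by
  have hω : ω ≠ 0 := by
    rintro rfl
    exact hr_nonconst ⟨b, fun x => by rw [hr]; simp⟩
  obtain rfl : r = fun x => ω • wedge σ x + b := funext hr
  have hc := inner_eq_zero_of_memH1tn hΩ hΓt_open hΓt_nonempty hω hσ hr_mem
  have hN := isRotationTangent_normalPart hΩ hω hσ hc hr_mem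
  refine ⟨hc, exists_countable_planes hΩ hΓt_open hω hσ hr_mem, fun q hq => ⟨?_, fun p hp => ?_⟩⟩
  -- A single surface of revolution contains all of Γ_n, hence each component.
  · obtain ⟨S, hS, hsub⟩ := hN.exists_isSurfaceOfRevolution sdiff_subset hΩ hσ ⟨q, hq⟩
    exact ⟨S, hS, (connectedComponentIn_subset _ q).trans hsub⟩
  · exact hN.exists_isAxisymmetric sdiff_subset hΩ hσ hp
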